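/- Let $\Sigma$ be a closed orientable surface of genus $g\ge 2$, so that $\pi_1\Sigma\cong\langle a_1,b_1,\dots,a_g,b_g \mid [a_1,b_1]\cdots[a_g,b_g]=1\rangle$, where $[a,b]=aba^{-1}b^{-1}$. Let $X(\pi_1\Sigma)$ be the set of all characters $\gamma\mapsto\operatorname{tr}\rho(\gamma)$ of representations $\rho\colon\pi_1\Sigma\to SL(2,\mathbb C)$. Regard it as a subset of $\mathbb C^n$ by means of $x\mapsto(x(c_1),\dots,x(c_n))$, where $c_1,\dots,c_n\in\pi_1\Sigma$ is any finite family such that for each $\gamma\in\pi_1\Sigma$ the function $x\mapsto x(\gamma)$ on $X(\pi_1\Sigma)$ is a polynomial with complex coefficients in the functions $x\mapsto x(c_1),\dots,x\mapsto x(c_n)$ (such families exist). Let $x_0\in X(\pi_1\Sigma)$ be the character of an irreducible representation $\rho_0\colon\pi_1\Sigma\to SL(2,\mathbb C)$, that is, one for which $0$ and $\mathbb C^2$ are the only invariant subspaces of $\mathbb C^2$. Then $x_0$ is a smooth point of the character variety $X(\pi_1\Sigma)$: some neighborhood of $x_0$ in $X(\pi_1\Sigma)$ is a ($C^\infty$,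 embedded) submanifold of $\mathbb C^n$. -/

import Mathlib

open scoped ContDiff MatrixGroups

/-! ### Surface groups -/

/-- The relator `[a₁, b₁] [a₂, b₂] ⋯ [a_g, b_g]` in the free group on the letters
`aᵢ = Sum.inl i` and `bᵢ = Sum.inr i`. -/
def surfaceRelator (g : ℕ) : FreeGroup (Fin g ⊕ Fin g) :=
  ((List.finRange g).map fun i =>
    FreeGroup.of (Sum.inl i) * FreeGroup.of (Sum.inr i) *
      (FreeGroup.of (Sum.inl i))⁻¹ * (FreeGroup.of (Sum.inr i))⁻¹).prod

/-- The standard presentation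
`⟨a₁, b₁, …, a_g, b_g ∣ [a₁, b₁] ⋯ [a_g, b_g]⟩` of the fundamental group of the closed orientable
surface of genus `g`. -/
abbrev SurfaceGroup (g : ℕ) : Type := PresentedGroup {surfaceRelator g}

/-- `Γ` is (isomorphic to) the fundamental group of the closed orientable surface of genus `g`. -/
def IsSurfaceGroup (g : ℕ) (Γ : Type*) [Group Γ] : Prop :=
  Nonempty (Γ ≃* SurfaceGroup g)

/-! ### Representations into `SL(2, ℂ)`, characters, the character variety -/

/-- A representation `ρ : Γ → SL(2, ℂ)` is irreducible if `0` and `ℂ²` are the only subspaces of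
`ℂ²` that are invariant under `ρ`. -/
def IsIrreducibleRep {Γ : Type*} [Group Γ] (ρ : Γ →* SL(2, ℂ)) : Prop :=
  ∀ W : Submodule ℂ (Fin 2 → ℂ),
    (∀ γ : Γ, ∀ v ∈ W, (ρ γ : Matrix (Fin 2) (Fin 2) ℂ).mulVec v ∈ W) → W = ⊥ ∨ W = ⊤

/-- The character `γ ↦ tr (ρ γ)` of a representation `ρ : Γ → SL(2, ℂ)`. -/
def repCharacter {Γ : Type*} [Group Γ] (ρ : Γ →* SL(2, ℂ)) : Γ → ℂ :=
  fun γ => (ρ γ : Matrix (Fin 2) (Fin 2) ℂ).trace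

/-- The character variety `X(Γ)`: the set of characters of all representations
`Γ → SL(2, ℂ)`. -/
def characterVariety (Γ : Type*) [Group Γ] : Set (Γ → ℂ) :=
  Set.range (repCharacter (Γ := Γ))

/-- A finite family `c₁, …, cₙ` of elements of `Γ` is a system of trace coordinates on `X(Γ)` if
every function `x ↦ x(γ)` on `X(Γ)` is a polynomial in the functions
`x ↦ x(c₁), …, x ↦ x(cₙ)`. Such a family identifies `X(Γ)` with a subset of `ℂⁿ`, and two such
families give subsets that correspond under mutually inverse polynomial maps. -/
def IsTraceCoordinates {Γ : Type*} [Group Γ] {n : ℕ} (c : Fin n → Γ) : Prop :=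
  ∀ γ : Γ, ∃ P : MvPolynomial (Fin n) ℂ,
    ∀ x ∈ characterVariety Γ, x γ = MvPolynomial.eval (fun i => x (c i)) P

/-- The coordinates `(x(c₁), …, x(cₙ)) ∈ ℂⁿ` of a character `x`. -/
def traceCoord {Γ : Type*} {n : ℕ} (c : Fin n → Γ) (x : Γ → ℂ) : Fin n → ℂ :=
  fun i => x (c i)

/-! ### Smooth points of subsets of affine space -/

/-- `M` is an (embedded) smooth submanifold of the real normed space `E`: around each of its points
there is a `C^∞` diffeomorphism between open subsets of `E` that takes `M` to a linear subspace. -/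
def IsSmoothSubmanifold {E : Type*} [NormedAddCommGroup E] [NormedSpace ℝ E] (M : Set E) : Prop :=
  ∀ p ∈ M, ∃ (φ : OpenPartialHomeomorph E E) (F : Submodule ℝ E),
    p ∈ φ.source ∧ ContDiffOn ℝ ∞ φ φ.source ∧ ContDiffOn ℝ ∞ φ.symm φ.target ∧
      ∀ q ∈ φ.source, q ∈ M ↔ φ q ∈ F

/-- `p` is a smooth point of `V`: some neighbourhood of `p` in `V` is a smooth submanifold of the
ambient space. -/
def IsSmoothPoint {E : Type*} [NormedAddCommGroup E] [NormedSpace ℝ E] (V : Set E) (p : E) : Prop :=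
  p ∈ V ∧ ∃ U : Set E, IsOpen U ∧ p ∈ U ∧ IsSmoothSubmanifold (V ∩ U)

/-! ### Trace coordinates exist on the character variety of a finitely generated group -/

section TraceCoordinates

variable {Γ : Type*} [Group Γ] {K : Type*} [CommRing K]

/-- The span, over the subring `T`, of the ordered monomials `X(s₁) ⋯ X(sᵣ)` with `s` a sublist
of `m`. -/
def monomialSpan (T : Subring K) (X : Γ →* Matrix (Fin 2) (Fin 2) K) (m : List Γ) :
    Submodule T (Matrix (Fin 2) (Fin 2) K) :=
  Submodule.span T {v | ∃ s : List Γ, s.Sublist m ∧ v = X s.prod}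

theorem monomialSpan_cons_mul (T : Subring K) (X : Γ →* Matrix (Fin 2) (Fin 2) K)
    (y : Γ) (m : List Γ) (v : Matrix (Fin 2) (Fin 2) K) (hv : v ∈ monomialSpan T X m) :
    X y * v ∈ monomialSpan T X (y :: m) := by
  induction hv using Submodule.span_induction with
  | mem w hw =>
    obtain ⟨s, hs, rfl⟩ := hw
    exact Submodule.subset_span ⟨y :: s, hs.cons_cons y, by simp⟩
  | zero => simp
  | add a b _ _ ha hb => rw [mul_add]; exact add_mem ha hb
  | smul t a _ ha => rw [mul_smul_comm]; exact Submodule.smul_mem _ _ ha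

theorem monomialSpan_mono (T : Subring K) (X : Γ →* Matrix (Fin 2) (Fin 2) K)
    (y : Γ) (m : List Γ) : monomialSpan T X m ≤ monomialSpan T X (y :: m) :=
  Submodule.span_mono fun _ ⟨s, hs, h⟩ => ⟨s, hs.cons y, h⟩

theorem monomialSpan_mul (T : Subring K) (X : Γ →* Matrix (Fin 2) (Fin 2) K)
    (hX : ∀ γ, (X γ).det = 1) (m : List Γ)
    (hT : ∀ s : List Γ, s.Sublist m → (X s.prod).trace ∈ T)
    (x : Γ) (hx : x ∈ m) (v : Matrix (Fin 2) (Fin 2) K) (hv : v ∈ monomialSpan T X m) :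
    X x * v ∈ monomialSpan T X m := by
  induction m generalizing x v with
  | nil => simp at hx
  | cons y m ih =>
    have ih' := ih fun s hs => hT s (hs.cons y)
    have hxT : ∀ z ∈ y :: m, (X z).trace ∈ T := fun z hz => by
      simpa using hT [z] (List.singleton_sublist.2 hz)
    have hyT := hxT y (by simp)
    induction hv using Submodule.span_induction with
    | zero => simp
    | add a b _ _ ha hb => rw [mul_add]; exact add_mem ha hb
    | smul t a _ ha => rw [mul_smul_comm]; exact Submodule.smul_mem _ _ ha
    | mem w hw =>
      obtain ⟨s', hs', rfl⟩ := hw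
      rcases List.sublist_cons_iff.1 hs' with hs | ⟨s, rfl, hs⟩
      · have hmem : X s'.prod ∈ monomialSpan T X m := Submodule.subset_span ⟨s', hs, rfl⟩
        rcases List.mem_cons.1 hx with rfl | hx
        · exact monomialSpan_cons_mul T X x m _ hmem
        · exact monomialSpan_mono T X y m (ih' x hx _ hmem)
      · have hZ : X s.prod ∈ monomialSpan T X m := Submodule.subset_span ⟨s, hs, rfl⟩
        have hyZ := monomialSpan_cons_mul T X y m _ hZ
        have hZ' := monomialSpan_mono T X y m hZ
        rw [List.prod_cons, map_mul]
        rcases List.mem_cons.1 hx with rfl | hx'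
        · have key : X x * (X x * X s.prod)
              = (⟨_, hyT⟩ : T) • (X x * X s.prod) - X s.prod := by
            have h := hX x
            rw [Matrix.det_fin_two] at h
            rw [← mul_assoc]
            have : X x * X x = (X x).trace • X x - 1 := by
              ext i j
              fin_cases i <;> fin_cases j <;>
                simp [Matrix.mul_apply, Matrix.trace_fin_two] <;>
                first | ring1 | linear_combination -h
            rw [this, sub_mul, one_mul, smul_mul_assoc]
            rfl
          rw [key]
          exact sub_mem (Submodule.smul_mem _ _ hyZ) hZ'
        · have hxyT : (X (y * x)).trace ∈ T := by
            simpa using hT [y, x] ((List.singleton_sublist.2 hx').cons_cons y)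
          have hxZ := ih' x hx' _ hZ
          have key : X x * (X y * X s.prod)
              = (⟨_, hxT x hx⟩ : T) • (X y * X s.prod) + (⟨_, hyT⟩ : T) • (X x * X s.prod)
                + ((⟨_, hxyT⟩ : T) - ⟨_, hxT x hx⟩ * ⟨_, hyT⟩) • X s.prod
                - X y * (X x * X s.prod) := by
            rw [← mul_assoc, ← mul_assoc]
            have : X x * X y = (X x).trace • X y + (X y).trace • X x
                + ((X y * X x).trace - (X x).trace * (X y).trace) • 1 - X y * X x := by
              ext i j
              fin_cases i <;> fin_cases j <;>
                simp [Matrix.mul_apply, Matrix.trace_fin_two] <;> ring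
            rw [this, sub_mul, add_mul, add_mul, smul_mul_assoc, smul_mul_assoc, smul_mul_assoc,
              one_mul, ← map_mul X y x]
            rfl
          rw [key]
          exact sub_mem (add_mem (add_mem (Submodule.smul_mem _ _ hyZ)
            (Submodule.smul_mem _ _ (monomialSpan_mono T X y m hxZ)))
            (Submodule.smul_mem _ _ hZ')) (monomialSpan_cons_mul T X y m _ hxZ)

theorem trace_mem_of_monomials (T : Subring K) (X : Γ →* Matrix (Fin 2) (Fin 2) K)
    (hX : ∀ γ, (X γ).det = 1) (m : List Γ)
    (hT : ∀ s : List Γ, s.Sublist m → (X s.prod).trace ∈ T)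
    (hm : Subgroup.closure {x | x ∈ m} = ⊤) (γ : Γ) : (X γ).trace ∈ T := by
  have h1 : X γ ∈ monomialSpan T X m := by
    have hγ : γ ∈ Subgroup.closure {x | x ∈ m} := hm ▸ Subgroup.mem_top γ
    induction hγ using Subgroup.closure_induction_left with
    | one => exact Submodule.subset_span ⟨[], List.nil_sublist _, by simp⟩
    | mul_left x hx y _ ih => rw [map_mul]; exact monomialSpan_mul T X hX m hT x hx _ ih
    | inv_mul_cancel x hx y _ ih =>
      have hxT : (X x).trace ∈ T := by
        simpa using hT [x] (List.singleton_sublist.2 hx)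
      have hinv : X x⁻¹ = (X x).trace • 1 - X x := by
        have h := hX x
        rw [Matrix.det_fin_two] at h
        have h2 : X x * ((X x).trace • 1 - X x) = 1 := by
          ext i j
          fin_cases i <;> fin_cases j <;>
            simp [Matrix.mul_apply, Matrix.trace_fin_two] <;>
            first | ring1 | linear_combination h
        calc X x⁻¹ = X x⁻¹ * (X x * ((X x).trace • 1 - X x)) := by rw [h2, mul_one]
          _ = _ := by rw [← mul_assoc, ← map_mul, inv_mul_cancel, map_one, one_mul]
      rw [map_mul, hinv, sub_mul, smul_mul_assoc, one_mul]
      exact sub_mem (Submodule.smul_mem _ (⟨_, hxT⟩ : T) ih)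
        (monomialSpan_mul T X hX m hT x hx _ ih)
  generalize X γ = v at h1
  induction h1 using Submodule.span_induction with
  | mem w hw => obtain ⟨s, hs, rfl⟩ := hw; exact hT s hs
  | zero => simp
  | add a b _ _ ha hb => rw [Matrix.trace_add]; exact add_mem ha hb
  | smul t a _ ha =>
    have : (t • a).trace = (t : K) * a.trace := Matrix.trace_smul (t : K) a
    rw [this]; exact mul_mem t.2 ha

/-- The character variety of a finitely generated group has trace coordinates, so it is a subset
of some `ℂⁿ`. -/
theorem exists_isTraceCoordinates (Γ : Type*) [Group Γ] [Group.FG Γ] :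
    ∃ (n : ℕ) (c : Fin n → Γ), IsTraceCoordinates c := by
  obtain ⟨S, hS⟩ := Group.fg_def.1 ‹Group.FG Γ›
  let L : List Γ := S.toList.sublists.map List.prod
  let c : Fin L.length → Γ := L.get
  let X : Γ →* Matrix (Fin 2) (Fin 2) ((Γ →* SL(2, ℂ)) → ℂ) :=
    { toFun := fun γ => Matrix.of fun i j ρ => (ρ γ : Matrix (Fin 2) (Fin 2) ℂ) i j
      map_one' := by
        ext i j ρ
        fin_cases i <;> fin_cases j <;> simp
      map_mul' := fun a b => by
        ext i j ρ
        simp [Matrix.mul_apply] }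
  let T := (MvPolynomial.aeval (R := ℂ)
    (fun i => (X (c i)).trace : Fin L.length → ((Γ →* SL(2, ℂ)) → ℂ))).range
  refine ⟨L.length, c, fun γ => ?_⟩
  have key : (X γ).trace ∈ T.toSubring := by
    refine trace_mem_of_monomials T.toSubring X (fun γ => ?_) S.toList (fun s hs => ?_) ?_ γ
    · funext ρ
      have := (ρ γ).2
      rw [Matrix.det_fin_two] at this ⊢
      exact this
    · have hs' : s.prod ∈ L := List.mem_map.2 ⟨s, List.mem_sublists.2 hs, rfl⟩
      obtain ⟨i, hi⟩ := List.get_of_mem hs'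
      exact ⟨MvPolynomial.X i, by rw [← hi]; simp [c]⟩
    · simpa using hS
  obtain ⟨P, hP⟩ := key
  refine ⟨P, ?_⟩
  rintro _ ⟨ρ, rfl⟩
  have h := congrFun hP ρ
  have h3 : (Pi.evalAlgHom ℂ (fun _ : (Γ →* SL(2, ℂ)) => ℂ) ρ).comp
      (MvPolynomial.aeval (fun i => (X (c i)).trace))
      = MvPolynomial.aeval (fun i => repCharacter ρ (c i)) := by
    refine MvPolynomial.algHom_ext fun i => ?_
    simp [repCharacter, X, Matrix.trace_fin_two]
  have h4 : (X γ).trace ρ = repCharacter ρ γ := by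
    simp [repCharacter, X, Matrix.trace_fin_two]
  rw [← h4, ← h]
  exact (DFunLike.congr_fun h3 P).trans (by rw [MvPolynomial.aeval_eq_eval])

end TraceCoordinates

/-! Near the coordinates `y₀` of `x₀`, the character variety `X` is the image of an analytic
retraction `t ∘ r ∘ s`, passing from `ℂⁿ` through tuples of `2 × 2` matrices (the images of the
generators) back to `ℂⁿ`. The image of such a retraction is a submanifold, since a retraction is
linearized by its own idempotent derivative (`isSmoothPoint_of_retraction`). Neither a quotient by
conjugation nor a dimension count is needed.

The lift `s` (`exists_section_repVariety`). Irreducibility gives `α`, `β` whose images `a`, `b`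
satisfy `det (ab - ba) ≠ 0`. Then the traces of `a`, `b`, `ab` determine the pair up to conjugation,
and `1, a, b, ab` is a basis of the matrix algebra, so traces against it determine any further
matrix. The map recording these traces is a submersion, and the traces are polynomials in the
coordinates of a character. A local section therefore lifts each character near `x₀` to a
representation with that character.

The retraction `r` (`exists_retraction_repVariety`). Representations are the tuples of determinant 1
that kill the relator. A trace-free matrix orthogonal, for the trace form, to the image of the
differential of the relator at `ρ₀` centralizes `ρ₀`, hence vanishes by Schur's lemma. So the
equations form a submersion at `ρ₀` (`surjective_fderiv_repEquations`), and a submersion has a local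
retraction onto its fibre. Adjugates in place of inverses make the equations polynomial on all
tuples.

Finally `t` takes traces of words. Near `y₀` the composite lands in `X`, because `r` produces
representations; on `X` it is the identity, because `s` already produces a representation, which `r`
fixes, with the given character. -/

open Filter Topology

local notation "M₂" => Matrix (Fin 2) (Fin 2) ℂ

/-! ### Images of analytic retractions are smooth -/

/-- A map that is analytic at `p` with derivative the identity is an analytic local
diffeomorphism at `p`. -/
theorem exists_openPartialHomeomorph_of_hasFDerivAt_id {𝕜 E : Type*} [RCLike 𝕜]
    [NormedAddCommGroup E] [NormedSpace 𝕜 E] [CompleteSpace E] {Ψ : E → E} {p : E}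
    (hΨ : ContDiffAt 𝕜 ω Ψ p) (hd : HasFDerivAt Ψ (ContinuousLinearMap.id 𝕜 E) p) :
    ∃ φ : OpenPartialHomeomorph E E, p ∈ φ.source ∧ (∀ x, φ x = Ψ x) ∧
      ContDiffAt 𝕜 ω φ.symm (Ψ p) := by
  have hd' : HasFDerivAt Ψ ((ContinuousLinearEquiv.refl 𝕜 E : E ≃L[𝕜] E) : E →L[𝕜] E) p := hd
  exact ⟨hΨ.toOpenPartialHomeomorph Ψ hd' (by simp),
    hΨ.mem_toOpenPartialHomeomorph_source hd' (by simp), fun _ => rfl,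
    hΨ.to_localInverse hd' (by simp)⟩

/-- A set that is locally the image of an analytic retraction is smooth. -/
theorem isSmoothPoint_of_retraction {E : Type*} [NormedAddCommGroup E] [NormedSpace ℝ E]
    [CompleteSpace E] {V : Set E} {p : E} (hp : p ∈ V) {r : E → E} (hr : ContDiffAt ℝ ω r p)
    (hrV : ∀ᶠ x in 𝓝 p, r x ∈ V) (hVr : ∀ᶠ x in 𝓝 p, x ∈ V → r x = x) :
    IsSmoothPoint V p := by
  have hrp : r p = p := hVr.self_of_nhds hp
  have hcont : Tendsto r (𝓝 p) (𝓝 p) := by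
    simpa [ContinuousAt, hrp] using hr.continuousAt
  have hrr : ∀ᶠ x in 𝓝 p, r (r x) = r x := by
    filter_upwards [hrV, hcont.eventually hVr] with x h1 h2 using h2 h1
  set L : E →L[ℝ] E := fderiv ℝ r p with hL
  have hrd : HasFDerivAt r L p := (hr.differentiableAt (by simp)).hasFDerivAt
  have hLL : ∀ v, L (L v) = L v := by
    have h1 : HasFDerivAt (r ∘ r) (L.comp L) p :=
      HasFDerivAt.comp p (by rw [hrp]; exact hrd) hrd
    have h2 : HasFDerivAt r (L.comp L) p := h1.congr_of_eventuallyEq (hrr.mono fun x hx => hx.symm)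
    intro v
    exact DFunLike.congr_fun (h2.unique hrd) v
  -- `Ψ = L ∘ r + (1 - L) ∘ (id - r)`. Since `L` is idempotent, the derivative at `p` is `L + (1 -
  -- L) = 1`; and `Ψ ∘ r = L ∘ Ψ`, so in this chart `r` becomes the projection `L` and its fixed
  -- points become `ker (1 - L)`.
  let Ψ : E → E := fun y => L (r y) + ((y - r y) - L (y - r y))
  have hΨ : ContDiffAt ℝ ω Ψ p := by
    have h1 : ContDiffAt ℝ ω (fun y => y - r y) p := contDiffAt_id.sub hr
    exact (L.contDiff.contDiffAt.comp p hr).add (h1.sub (L.contDiff.contDiffAt.comp p h1))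
  have hd : HasFDerivAt Ψ (ContinuousLinearMap.id ℝ E) p := by
    have h1 : HasFDerivAt (fun y => y - r y) (ContinuousLinearMap.id ℝ E - L) p :=
      (hasFDerivAt_id p).sub hrd
    have h2 := (L.hasFDerivAt.comp p hrd).add (h1.sub (L.hasFDerivAt.comp p h1))
    convert! h2 using 1
    ext v
    simp [hLL]
  obtain ⟨φ, hpφ, hφ, hφs⟩ := exists_openPartialHomeomorph_of_hasFDerivAt_id hΨ hd
  -- Both `x` and `r x` must lie in the chart: injectivity there recovers `r x = x` from `φ (r x) =
  -- φ x`.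
  have ev : ∀ᶠ x in 𝓝 p, x ∈ φ.source ∧ r x ∈ φ.source ∧ ContDiffAt ℝ ω φ x ∧
      ContDiffAt ℝ ω φ.symm (φ x) ∧ r (r x) = r x ∧ r x ∈ V ∧ (x ∈ V → r x = x) := by
    have e0 := φ.open_source.mem_nhds hpφ
    have e1 : ∀ᶠ x in 𝓝 p, ContDiffAt ℝ ω φ x := by
      have : (φ : E → E) = Ψ := funext hφ
      rw [this]
      exact hΨ.eventually (by simp)
    have e2 : ∀ᶠ x in 𝓝 p, ContDiffAt ℝ ω φ.symm (φ x) := by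
      refine (φ.continuousAt hpφ).eventually ?_
      rw [hφ]
      exact hφs.eventually (by simp)
    filter_upwards [e0, hcont.eventually e0, e1, e2, hrr, hrV, hVr] with x h1 h2 h3 h4 h5 h6 h7
    exact ⟨h1, h2, h3, h4, h5, h6, h7⟩
  obtain ⟨U, hU, hUo, hpU⟩ := eventually_nhds_iff.1 ev
  have hsrc : (φ.restrOpen U hUo).source = U := by
    rw [φ.restrOpen_source]
    exact Set.inter_eq_right.2 fun x hx => (hU x hx).1
  refine ⟨hp, U, hUo, hpU, fun q hq => ⟨φ.restrOpen U hUo, LinearMap.ker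
    ((ContinuousLinearMap.id ℝ E - L : E →L[ℝ] E) : E →ₗ[ℝ] E), ?_, ?_, ?_, ?_⟩⟩
  · rw [hsrc]; exact hq.2
  · rw [hsrc]
    intro x hx
    exact ((hU x hx).2.2.1.of_le le_top).contDiffWithinAt
  · intro y hy
    have h1 := (φ.restrOpen U hUo).map_target hy
    rw [hsrc] at h1
    have h2 := (hU _ h1).2.2.2.1
    have h3 : φ ((φ.restrOpen U hUo).symm y) = y := (φ.restrOpen U hUo).right_inv hy
    rw [h3] at h2
    exact (h2.of_le le_top).contDiffWithinAt
  · rw [hsrc]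
    intro x hx
    obtain ⟨hx1, hx2, -, -, hx5, hx6, hx7⟩ := hU x hx
    have key : φ (r x) = L (φ x) := by
      rw [hφ, hφ]
      simp [Ψ, hx5, hLL]
    have h1 : x ∈ V ∩ U ↔ r x = x :=
      ⟨fun h => hx7 h.1, fun h => ⟨h ▸ hx6, hx⟩⟩
    have h2 : (φ.restrOpen U hUo) x = φ x := rfl
    rw [h1, h2, LinearMap.mem_ker]
    have h3 : (ContinuousLinearMap.id ℝ E - L) (φ x) = φ x - φ (r x) := by
      rw [key]; rfl
    constructor
    · intro h
      change (ContinuousLinearMap.id ℝ E - L) (φ x) = 0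
      rw [h3, h, sub_self]
    · intro h
      change (ContinuousLinearMap.id ℝ E - L) (φ x) = 0 at h
      rw [h3, sub_eq_zero] at h
      exact (φ.injOn hx1 hx2 h).symm

/-! ### Analytic submersions: local sections and retractions onto fibres -/

section Submersion

variable {𝕜 E G : Type*} [RCLike 𝕜] [NormedAddCommGroup E] [NormedSpace 𝕜 E] [CompleteSpace E]
  [NormedAddCommGroup G] [NormedSpace 𝕜 G] [FiniteDimensional 𝕜 G]

/-- An analytic submersion becomes linear in a suitable analytic chart of its source. -/
theorem exists_straightening {f : E → G} {f' : E →L[𝕜] G} {p : E} (hf : ContDiffAt 𝕜 ω f p)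
    (hf' : HasFDerivAt f f' p) (hs : Function.Surjective f') :
    ∃ (φ : OpenPartialHomeomorph E E) (K : G →L[𝕜] E), p ∈ φ.source ∧ ContDiffAt 𝕜 ω φ p ∧
      ContDiffAt 𝕜 ω φ.symm (φ p) ∧ (∀ y, f' (K y) = y) ∧ ∀ x, f' (φ x) = f x := by
  obtain ⟨K₀, hK₀⟩ := (f' : E →ₗ[𝕜] G).exists_rightInverse_of_surjective
    (LinearMap.range_eq_top.2 hs)
  let K : G →L[𝕜] E := LinearMap.toContinuousLinearMap K₀
  have hK : ∀ y, f' (K y) = y := fun y => DFunLike.congr_fun hK₀ y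
  -- Replacing the `K`-component of `e` by `K (f e)` gives `f' ∘ Ψ = f`, and the change vanishes to
  -- first order at `p`.
  let Ψ : E → E := fun e => (e - K (f' e)) + K (f e)
  have hΨ : ContDiffAt 𝕜 ω Ψ p :=
    (contDiffAt_id.sub (K.comp f').contDiff.contDiffAt).add (K.contDiff.contDiffAt.comp p hf)
  have hd : HasFDerivAt Ψ (ContinuousLinearMap.id 𝕜 E) p := by
    have h2 := ((hasFDerivAt_id p).sub (K.comp f').hasFDerivAt).add (K.hasFDerivAt.comp p hf')
    convert! h2 using 1
    ext v
    simp
  obtain ⟨φ, hpφ, hφ, hφs⟩ := exists_openPartialHomeomorph_of_hasFDerivAt_id hΨ hd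
  refine ⟨φ, K, hpφ, ?_, by rwa [hφ], hK, fun x => ?_⟩
  · rwa [funext hφ]
  · rw [hφ]; simp [Ψ, hK]

/-- An analytic submersion has an analytic local section. -/
theorem exists_local_section {f : E → G} {f' : E →L[𝕜] G} {p : E} (hf : ContDiffAt 𝕜 ω f p)
    (hf' : HasFDerivAt f f' p) (hs : Function.Surjective f') :
    ∃ σ : G → E, ContDiffAt 𝕜 ω σ (f p) ∧ σ (f p) = p ∧ ∀ᶠ y in 𝓝 (f p), f (σ y) = y := by
  obtain ⟨φ, K, hp, -, hφs, hK, hφ⟩ := exists_straightening hf hf' hs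
  let ψ : G → E := fun y => φ p + K (y - f p)
  have hψ : ContDiffAt 𝕜 ω ψ (f p) :=
    contDiffAt_const.add (K.contDiff.contDiffAt.comp _ (contDiffAt_id.sub contDiffAt_const))
  have hψp : ψ (f p) = φ p := by simp [ψ]
  refine ⟨φ.symm ∘ ψ, ContDiffAt.comp _ (by rwa [hψp]) hψ, ?_, ?_⟩
  · rw [Function.comp_apply, hψp, φ.left_inv hp]
  · have h1 : ∀ᶠ y in 𝓝 (f p), ψ y ∈ φ.target :=
      hψ.continuousAt.eventually
        (by rw [hψp]; exact φ.open_target.mem_nhds (φ.map_source hp))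
    filter_upwards [h1] with y hy
    rw [Function.comp_apply, ← hφ, φ.right_inv hy]
    simp [ψ, hK, hφ]

/-- Near a point where it is a submersion, an analytic map admits an analytic retraction onto its
fibre. -/
theorem exists_local_retraction {f : E → G} {f' : E →L[𝕜] G} {p : E} (hf : ContDiffAt 𝕜 ω f p)
    (hf' : HasFDerivAt f f' p) (hs : Function.Surjective f') :
    ∃ ρ : E → E, ContDiffAt 𝕜 ω ρ p ∧ ρ p = p ∧ (∀ᶠ e in 𝓝 p, f (ρ e) = f p) ∧
      ∀ᶠ e in 𝓝 p, f e = f p → ρ e = e := by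
  obtain ⟨φ, K, hp, hφc, hφs, hK, hφ⟩ := exists_straightening hf hf' hs
  -- In the chart `f` is the linear map `f'`, so subtracting `K (f e - f p)` moves the point into
  -- the fibre over `f p`, and does nothing to points already there.
  let ψ : E → E := fun e => φ e - K (f e - f p)
  have hψ : ContDiffAt 𝕜 ω ψ p :=
    hφc.sub (K.contDiff.contDiffAt.comp _ (hf.sub contDiffAt_const))
  have hψp : ψ p = φ p := by simp [ψ]
  refine ⟨φ.symm ∘ ψ, ContDiffAt.comp _ (by rwa [hψp]) hψ, ?_, ?_, ?_⟩
  · rw [Function.comp_apply, hψp, φ.left_inv hp]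
  · have h1 : ∀ᶠ y in 𝓝 p, ψ y ∈ φ.target :=
      hψ.continuousAt.eventually
        (by rw [hψp]; exact φ.open_target.mem_nhds (φ.map_source hp))
    filter_upwards [h1] with y hy
    rw [Function.comp_apply, ← hφ, φ.right_inv hy]
    simp [ψ, hK, hφ]
  · filter_upwards [φ.open_source.mem_nhds hp] with e he h
    simp [ψ, h, φ.left_inv he]

end Submersion

/-! ### Pairs of `2 × 2` matrices and their traces -/

section TwoByTwo

open Matrix

/-- The determinant of the matrix with columns `v` and `w`. -/
def crossDet (v w : Fin 2 → ℂ) : ℂ := v 0 * w 1 - v 1 * w 0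

theorem exists_smul_of_crossDet_eq_zero {v w : Fin 2 → ℂ} (hv : v ≠ 0) (h : crossDet v w = 0) :
    ∃ c : ℂ, w = c • v := by
  unfold crossDet at h
  by_cases h0 : v 0 = 0
  · have h1 : v 1 ≠ 0 := fun h1 => hv (by ext i; fin_cases i <;> simp [h0, h1])
    refine ⟨w 1 / v 1, ?_⟩
    have : w 0 = 0 := by
      have : v 1 * w 0 = 0 := by linear_combination -h + w 1 * h0
      exact (mul_eq_zero.1 this).resolve_left h1
    ext i; fin_cases i
    · simp [h0, this]
    · simp [h1]
  · refine ⟨w 0 / v 0, ?_⟩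
    ext i; fin_cases i
    · simp [h0]
    · simp only [Fin.mk_one, Pi.smul_apply, smul_eq_mul]
      field_simp
      linear_combination h

theorem crossDet_smul (v : Fin 2 → ℂ) (c : ℂ) : crossDet v (c • v) = 0 := by
  simp [crossDet]; ring

theorem eq_zero_of_mulVec_eq_zero_of_crossDet {N : Matrix (Fin 2) (Fin 2) ℂ} {v w : Fin 2 → ℂ}
    (h : crossDet v w ≠ 0) (hv : N *ᵥ v = 0) (hw : N *ᵥ w = 0) : N = 0 := by
  have e1 : ∀ i, N i 0 * v 0 + N i 1 * v 1 = 0 := fun i => by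
    simpa [mulVec, dotProduct, Fin.sum_univ_two] using congrFun hv i
  have e2 : ∀ i, N i 0 * w 0 + N i 1 * w 1 = 0 := fun i => by
    simpa [mulVec, dotProduct, Fin.sum_univ_two] using congrFun hw i
  have f0 : ∀ i, N i 0 = 0 := fun i => by
    refine (mul_eq_zero.1 ?_).resolve_right h
    unfold crossDet
    linear_combination w 1 * e1 i - v 1 * e2 i
  have f1 : ∀ i, N i 1 = 0 := fun i => by
    refine (mul_eq_zero.1 ?_).resolve_right h
    unfold crossDet
    linear_combination v 0 * e2 i - w 0 * e1 i
  ext i j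
  fin_cases j
  · exact f0 i
  · exact f1 i

/-- Roots of the characteristic polynomial are eigenvalues. -/
theorem exists_mulVec_eq_smul {a : Matrix (Fin 2) (Fin 2) ℂ} {l : ℂ}
    (hl : l * l - a.trace * l + a.det = 0) : ∃ v : Fin 2 → ℂ, v ≠ 0 ∧ a *ᵥ v = l • v := by
  have : (a - l • (1 : Matrix (Fin 2) (Fin 2) ℂ)).det = 0 := by
    rw [trace_fin_two, det_fin_two] at hl
    simp [det_fin_two]
    linear_combination hl
  obtain ⟨v, hv, h⟩ := exists_mulVec_eq_zero_iff.2 this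
  refine ⟨v, hv, ?_⟩
  rw [sub_mulVec, smul_mulVec, one_mulVec, sub_eq_zero] at h
  exact h

theorem exists_charpoly_root (t d : ℂ) : ∃ l : ℂ, l * l - t * l + d = 0 := by
  obtain ⟨s, hs⟩ := IsAlgClosed.exists_eq_mul_self (t * t - 4 * d)
  exact ⟨(t + s) / 2, by linear_combination -hs / 4⟩

theorem charpoly_eq_zero_of_mulVec {a : Matrix (Fin 2) (Fin 2) ℂ} {l : ℂ} {v : Fin 2 → ℂ}
    (hv : v ≠ 0) (h : a *ᵥ v = l • v) : l * l - a.trace * l + a.det = 0 := by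
  have : (a - l • (1 : Matrix (Fin 2) (Fin 2) ℂ)).det = 0 :=
    exists_mulVec_eq_zero_iff.1 ⟨v, hv, by
      rw [sub_mulVec, smul_mulVec, one_mulVec, h, sub_self]⟩
  simp [det_fin_two] at this
  rw [trace_fin_two, det_fin_two]
  linear_combination this

theorem eq_smul_one_of_eigenvectors {a : Matrix (Fin 2) (Fin 2) ℂ} {l : ℂ} {v w : Fin 2 → ℂ}
    (h : crossDet v w ≠ 0) (hv : a *ᵥ v = l • v) (hw : a *ᵥ w = l • w) :
    a = l • (1 : Matrix (Fin 2) (Fin 2) ℂ) := by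
  rw [← sub_eq_zero]
  refine eq_zero_of_mulVec_eq_zero_of_crossDet h ?_ ?_ <;>
    simp [sub_mulVec, smul_mulVec, hv, hw]

theorem exists_eigenvector (a : Matrix (Fin 2) (Fin 2) ℂ) :
    ∃ (l : ℂ) (v : Fin 2 → ℂ), v ≠ 0 ∧ a *ᵥ v = l • v := by
  obtain ⟨l, hl⟩ := exists_charpoly_root a.trace a.det
  obtain ⟨v, hv⟩ := exists_mulVec_eq_smul hl
  exact ⟨l, v, hv⟩

/-- Two matrices with singular commutator have a common eigenvector. -/
theorem exists_common_eigenvector {a b : Matrix (Fin 2) (Fin 2) ℂ}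
    (h : (a * b - b * a).det = 0) :
    ∃ v : Fin 2 → ℂ, v ≠ 0 ∧ crossDet v (a *ᵥ v) = 0 ∧ crossDet v (b *ᵥ v) = 0 := by
  obtain ⟨w, hw, hab⟩ := exists_mulVec_eq_zero_iff.2 h
  rw [sub_mulVec, sub_eq_zero, ← mulVec_mulVec, ← mulVec_mulVec] at hab
  by_cases h1 : crossDet w (a *ᵥ w) = 0
  · by_cases h2 : crossDet w (b *ᵥ w) = 0
    · exact ⟨w, hw, h1, h2⟩
    -- Here `w` and `b w` are independent eigenvectors of `a` for the same eigenvalue, so `a` is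
    -- scalar and any eigenvector of `b` serves.
    · obtain ⟨l, hl⟩ := exists_smul_of_crossDet_eq_zero hw h1
      have ha := eq_smul_one_of_eigenvectors (a := a) h2 hl (by rw [hab, hl, mulVec_smul])
      obtain ⟨m, v, hv, hb⟩ := exists_eigenvector b
      refine ⟨v, hv, ?_, ?_⟩
      · rw [ha, smul_mulVec, one_mulVec, crossDet_smul]
      · rw [hb, crossDet_smul]
  -- Now `w, a w` is a basis. Writing `b w = p w + q a w`, the relation `a b w = b a w` forces `b =
  -- p + q a`, so every eigenvector of `a` is one of `b`.
  · obtain ⟨p, q, hpq⟩ : ∃ p q : ℂ, b *ᵥ w = p • w + q • (a *ᵥ w) := by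
      generalize a *ᵥ w = u at h1
      generalize b *ᵥ w = x
      refine ⟨crossDet x u / crossDet w u, crossDet w x / crossDet w u, ?_⟩
      ext i
      fin_cases i <;> simp <;> field_simp <;> unfold crossDet <;> ring
    have hb : b - (p • (1 : Matrix (Fin 2) (Fin 2) ℂ) + q • a) = 0 := by
      refine eq_zero_of_mulVec_eq_zero_of_crossDet h1 ?_ ?_
      · simp [sub_mulVec, add_mulVec, smul_mulVec, hpq]
      · rw [sub_mulVec, add_mulVec, smul_mulVec, smul_mulVec, one_mulVec, ← hab, hpq,
          mulVec_add, mulVec_smul, mulVec_smul, sub_self]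
    obtain ⟨l, v, hv, ha⟩ := exists_eigenvector a
    refine ⟨v, hv, by rw [ha, crossDet_smul], ?_⟩
    rw [sub_eq_zero.1 hb, add_mulVec, smul_mulVec, smul_mulVec, one_mulVec, ha, smul_smul,
      ← add_smul, crossDet_smul]

/-- The rows are the entries of `1, a, b, a * b` in transposed order, so that the product with the
vector of entries of `N` consists of the traces of `N` against these four matrices. -/
theorem coords_det (a b : Matrix (Fin 2) (Fin 2) ℂ) :
    (!![1, 0, 0, 1; a 0 0, a 1 0, a 0 1, a 1 1; b 0 0, b 1 0, b 0 1, b 1 1;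
      (a * b) 0 0, (a * b) 1 0, (a * b) 0 1, (a * b) 1 1] : Matrix (Fin 4) (Fin 4) ℂ).det
      = -(a * b - b * a).det := by
  simp [det_succ_row_zero, Fin.sum_univ_succ, Fin.succAbove, mul_apply]
  ring

/-- If `a` and `b` have invertible commutator, then `1, a, b, a * b` span the matrix algebra, so the
traces against them determine a matrix. -/
theorem eq_zero_of_trace_mul_eq_zero {a b N : Matrix (Fin 2) (Fin 2) ℂ}
    (h : (a * b - b * a).det ≠ 0) (h0 : N.trace = 0) (h1 : (N * a).trace = 0)
    (h2 : (N * b).trace = 0) (h3 : (N * (a * b)).trace = 0) : N = 0 := by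
  rw [← neg_ne_zero, ← coords_det] at h
  have := eq_zero_of_mulVec_eq_zero h (v := ![N 0 0, N 0 1, N 1 0, N 1 1]) (by
    generalize a * b = c at h3
    simp only [trace_fin_two, mul_apply, Fin.sum_univ_two] at h0 h1 h2 h3
    ext i
    fin_cases i
    · simp [mulVec, dotProduct, Fin.sum_univ_succ]; linear_combination h0
    · simp [mulVec, dotProduct, Fin.sum_univ_succ]; linear_combination h1
    · simp [mulVec, dotProduct, Fin.sum_univ_succ]; linear_combination h2
    · simp [mulVec, dotProduct, Fin.sum_univ_succ]; linear_combination h3)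
  ext i j
  fin_cases i <;> fin_cases j
  · exact congrFun this 0
  · exact congrFun this 1
  · exact congrFun this 2
  · exact congrFun this 3

/-- A pair of unimodular matrices without common eigenvector is conjugate to a normal form that
depends only on traces and on an eigenvalue of the first matrix. -/
theorem exists_normal_form {a b : Matrix (Fin 2) (Fin 2) ℂ} (hb : b.det = 1)
    (h : (a * b - b * a).det ≠ 0) {l : ℂ} (hl : l * l - a.trace * l + a.det = 0) :
    ∃ P : Matrix (Fin 2) (Fin 2) ℂ, P.det ≠ 0 ∧
      a * P = P * !![l, (a * b).trace - b.trace * (a.trace - l); 0, a.trace - l] ∧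
      b * P = P * !![0, -1; 1, b.trace] := by
  obtain ⟨v, hv, hav⟩ := exists_mulVec_eq_smul hl
  have e : ∀ i, a i 0 * v 0 + a i 1 * v 1 = l * v i := fun i => by
    simpa [mulVec, dotProduct, Fin.sum_univ_two] using congrFun hav i
  have e0 := e 0
  have e1 := e 1
  rw [det_fin_two] at hb
  -- The basis is `v, b v`. If it were dependent, `v` would be a common eigenvector, killed by `a b
  -- - b a`. The second columns of the two normal forms come from `det b = 1`, the traces and `a v =
  -- l v`.
  refine ⟨!![v 0, (b *ᵥ v) 0; v 1, (b *ᵥ v) 1], ?_, ?_, ?_⟩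
  · intro hdet
    have hc : crossDet v (b *ᵥ v) = 0 := by
      rw [det_fin_two] at hdet
      simp at hdet
      unfold crossDet
      simp
      linear_combination hdet
    obtain ⟨c, hc⟩ := exists_smul_of_crossDet_eq_zero hv hc
    refine h (exists_mulVec_eq_zero_iff.1 ⟨v, hv, ?_⟩)
    rw [sub_mulVec, ← mulVec_mulVec, ← mulVec_mulVec, hc, hav, mulVec_smul, mulVec_smul, hav, hc,
      smul_comm, sub_self]
  · ext i j
    fin_cases i <;> fin_cases j <;>
      simp [mul_apply, mulVec, dotProduct, Fin.sum_univ_two, trace_fin_two]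
    · linear_combination e0
    · linear_combination b 1 1 * e0 - b 0 1 * e1
    · linear_combination e1
    · linear_combination b 0 0 * e1 - b 1 0 * e0
  · ext i j
    fin_cases i <;> fin_cases j <;>
      simp [mul_apply, mulVec, dotProduct, Fin.sum_univ_two, trace_fin_two]
    · linear_combination -v 0 * hb
    · linear_combination -v 1 * hb

/-- Pairs in `SL(2, ℂ)` without common eigenvector are determined up to conjugation by traces. -/
theorem exists_conj_of_trace_eq {a b A B : SL(2, ℂ)}
    (h : ((a : M₂) * (b : M₂) - (b : M₂) * (a : M₂)).det ≠ 0) (H : ((A : M₂) * (B : M₂) - (B : M₂) * (A : M₂)).det ≠ 0)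
    (h1 : (a : M₂).trace = (A : M₂).trace) (h2 : (b : M₂).trace = (B : M₂).trace)
    (h3 : ((a : M₂) * (b : M₂)).trace = ((A : M₂) * (B : M₂)).trace) :
    ∃ P : SL(2, ℂ), P * a * P⁻¹ = A ∧ P * b * P⁻¹ = B := by
  -- One root `l` serves both pairs, as `a` and `A` have the same characteristic polynomial; the two
  -- normal forms then coincide.
  obtain ⟨l, hl⟩ := exists_charpoly_root (a : M₂).trace 1
  obtain ⟨P, hP, hPa, hPb⟩ := exists_normal_form b.2 h (l := l) (by rw [a.2]; exact hl)
  obtain ⟨Q, hQ, hQA, hQB⟩ := exists_normal_form B.2 H (l := l) (by rw [A.2, ← h1]; exact hl)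
  rw [← h1, ← h2, ← h3] at hQA
  rw [← h2] at hQB
  have hPu : IsUnit P.det := isUnit_iff_ne_zero.2 hP
  have conj : ∀ {x y n : Matrix (Fin 2) (Fin 2) ℂ}, x * P = P * n → y * Q = Q * n →
      (Q * P⁻¹) * x = y * (Q * P⁻¹) := by
    intro x y n hx hy
    calc (Q * P⁻¹) * x = Q * P⁻¹ * (x * P) * P⁻¹ := by
          rw [← mul_assoc _ x P, mul_nonsing_inv_cancel_right _ _ hPu]
      _ = Q * (P⁻¹ * P) * n * P⁻¹ := by rw [hx]; simp only [mul_assoc]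
      _ = y * (Q * P⁻¹) := by rw [nonsing_inv_mul _ hPu, mul_one, ← hy, mul_assoc]
  have hR : (Q * P⁻¹).det ≠ 0 := by
    rw [det_mul, det_nonsing_inv]
    simp [hP, hQ]
  have ha := conj hPa hQA
  have hb := conj hPb hQB
  generalize Q * P⁻¹ = R at hR ha hb
  -- Dividing the conjugating matrix by a square root of its determinant puts it in `SL(2, ℂ)`.
  obtain ⟨s, hs⟩ := IsAlgClosed.exists_eq_mul_self R.det
  have hs0 : s ≠ 0 := by rintro rfl; simp at hs; exact hR hs
  obtain ⟨T, hT⟩ : ∃ T : SL(2, ℂ), (T : M₂) = s⁻¹ • R :=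
    ⟨⟨s⁻¹ • R, by rw [det_smul, hs]; simp; field_simp⟩, rfl⟩
  refine ⟨T, ?_, ?_⟩
  · rw [mul_inv_eq_iff_eq_mul]
    apply Subtype.ext
    change (T : M₂) * (a : M₂) = (A : M₂) * (T : M₂)
    rw [hT, smul_mul_assoc, ha, mul_smul_comm]
  · rw [mul_inv_eq_iff_eq_mul]
    apply Subtype.ext
    change (T : M₂) * (b : M₂) = (B : M₂) * (T : M₂)
    rw [hT, smul_mul_assoc, hb, mul_smul_comm]

end TwoByTwo

/-! ### Irreducible representations -/

section Irreducible

open Matrix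

variable {Γ : Type*} [Group Γ]

theorem coe_rep_mul (ρ : Γ →* SL(2, ℂ)) (x y : Γ) :
    (ρ (x * y) : M₂) = (ρ x : M₂) * (ρ y : M₂) := by
  rw [map_mul]; rfl

/-- The elements that preserve the line spanned by `v`. -/
def lineStabilizer (ρ : Γ →* SL(2, ℂ)) (v : Fin 2 → ℂ) : Subgroup Γ where
  carrier := {γ | ∃ c : ℂ, (ρ γ : M₂) *ᵥ v = c • v}
  one_mem' := ⟨1, by simp⟩
  mul_mem' := by
    rintro x y ⟨c, hc⟩ ⟨d, hd⟩
    exact ⟨d * c, by rw [coe_rep_mul, ← mulVec_mulVec, hd, mulVec_smul, hc,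
      smul_smul]⟩
  inv_mem' := by
    rintro x ⟨c, hc⟩
    have h1 : (ρ x⁻¹ : M₂) *ᵥ ((ρ x : M₂) *ᵥ v) = v := by
      rw [mulVec_mulVec, ← coe_rep_mul]; simp
    rw [hc, mulVec_smul] at h1
    by_cases hc0 : c = 0
    · subst hc0
      rw [zero_smul] at h1
      exact ⟨0, by rw [← h1]; simp⟩
    · exact ⟨c⁻¹, by nth_rewrite 2 [← h1]; rw [smul_smul, inv_mul_cancel₀ hc0, one_smul]⟩

theorem IsIrreducibleRep.exists_notMem_lineStabilizer {ρ : Γ →* SL(2, ℂ)}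
    (hρ : IsIrreducibleRep ρ) {v : Fin 2 → ℂ} (hv : v ≠ 0) : ∃ γ, γ ∉ lineStabilizer ρ v := by
  by_contra! hall
  rcases hρ (Submodule.span ℂ {v}) (fun γ w hw => by
    obtain ⟨c, rfl⟩ := Submodule.mem_span_singleton.1 hw
    obtain ⟨d, hd⟩ := hall γ
    rw [mulVec_smul, hd]
    exact Submodule.smul_mem _ _ (Submodule.smul_mem _ _ (Submodule.mem_span_singleton_self v)))
    with h | h
  · exact hv (by simpa using h)
  · have := finrank_span_singleton (K := ℂ) hv
    rw [h, finrank_top] at this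
    simp at this

/-- An irreducible representation contains two elements without common eigenvector. -/
theorem IsIrreducibleRep.exists_commutator_det_ne_zero {ρ : Γ →* SL(2, ℂ)}
    (hρ : IsIrreducibleRep ρ) :
    ∃ α β : Γ, ((ρ α : M₂) * (ρ β : M₂) - (ρ β : M₂) * (ρ α : M₂)).det ≠ 0 := by
  by_contra! hall
  -- The vector is arbitrary: all that matters is that `ρ α` is not scalar, so that each of its
  -- eigenspaces is a line.
  obtain ⟨α, hα⟩ := hρ.exists_notMem_lineStabilizer (v := ![1, 0]) (by
    intro h; simpa using congrFun h 0)
  obtain ⟨l, hl⟩ := exists_charpoly_root (ρ α : M₂).trace (ρ α : M₂).det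
  obtain ⟨v, hv, hlv⟩ := exists_mulVec_eq_smul hl
  have hm : ((ρ α : M₂).trace - l) * ((ρ α : M₂).trace - l) - (ρ α : M₂).trace * ((ρ α : M₂).trace - l)
      + (ρ α : M₂).det = 0 := by linear_combination hl
  obtain ⟨w, hw, hmw⟩ := exists_mulVec_eq_smul hm
  have hns : ∀ (k : ℂ) (x y : Fin 2 → ℂ), (ρ α : M₂) *ᵥ x = k • x → (ρ α : M₂) *ᵥ y = k • y →
      crossDet x y = 0 := by
    intro k x y hx hy
    by_contra hxy
    refine hα ⟨k, ?_⟩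
    rw [eq_smul_one_of_eigenvectors hxy hx hy, smul_mulVec, one_mulVec]
  -- By assumption each `ρ β` shares an eigenvector with `ρ α`, whose only eigenlines are those of
  -- `v` and `w`.
  have hcov : ∀ β, β ∈ lineStabilizer ρ v ∨ β ∈ lineStabilizer ρ w := by
    intro β
    obtain ⟨u, hu, hau, hbu⟩ := exists_common_eigenvector (hall α β)
    obtain ⟨k, hk⟩ := exists_smul_of_crossDet_eq_zero hu hau
    obtain ⟨d, hd⟩ := exists_smul_of_crossDet_eq_zero hu hbu
    have key : ∀ x : Fin 2 → ℂ, (ρ α : M₂) *ᵥ x = k • x → β ∈ lineStabilizer ρ x := by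
      intro x hx
      obtain ⟨c, rfl⟩ := exists_smul_of_crossDet_eq_zero hu (hns k u x hk hx)
      exact ⟨d, by rw [mulVec_smul, hd, smul_comm]⟩
    have hk' := charpoly_eq_zero_of_mulVec hu hk
    have : (k - l) * (k - ((ρ α : M₂).trace - l)) = 0 := by linear_combination hk' - hl
    rcases mul_eq_zero.1 this with h | h
    · exact Or.inl (key v (by rw [hlv, sub_eq_zero.1 h]))
    · exact Or.inr (key w (by rw [hmw, sub_eq_zero.1 h]))
  obtain ⟨β₁, h1⟩ := hρ.exists_notMem_lineStabilizer hv
  obtain ⟨β₂, h2⟩ := hρ.exists_notMem_lineStabilizer hw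
  have h1' := (hcov β₁).resolve_left h1
  have h2' := (hcov β₂).resolve_right h2
  -- A group is not the union of two proper subgroups.
  rcases hcov (β₁ * β₂) with h | h
  · exact h1 (((lineStabilizer ρ v).mul_mem_cancel_right h2').1 h)
  · exact h2 (((lineStabilizer ρ w).mul_mem_cancel_left h1').1 h)

/-- Schur's lemma for trace-free matrices. -/
theorem IsIrreducibleRep.eq_zero_of_commute {ρ : Γ →* SL(2, ℂ)} (hρ : IsIrreducibleRep ρ)
    {ξ : Matrix (Fin 2) (Fin 2) ℂ} (htr : ξ.trace = 0) (hξ : ∀ γ, Commute ξ (ρ γ : M₂)) : ξ = 0 := by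
  obtain ⟨l, v, hv, hl⟩ := exists_eigenvector ξ
  obtain ⟨γ, hγ⟩ := hρ.exists_notMem_lineStabilizer hv
  have hc : crossDet v ((ρ γ : M₂) *ᵥ v) ≠ 0 := fun h =>
    hγ (exists_smul_of_crossDet_eq_zero hv h)
  have h := eq_smul_one_of_eigenvectors hc hl (by
    rw [mulVec_mulVec, (hξ γ).eq, ← mulVec_mulVec, hl, mulVec_smul])
  rw [h] at htr ⊢
  simp at htr
  simp [htr]

end Irreducible

/-! ### The differential of the surface relator -/

section RelatorMap

open Matrix
open scoped Matrix.Norms.Operator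

/-- The trace as a continuous linear map. -/
noncomputable def traceL : M₂ →L[ℂ] ℂ :=
  LinearMap.toContinuousLinearMap (traceLinearMap (Fin 2) ℂ ℂ)

@[simp] theorem traceL_apply (A : M₂) : traceL A = A.trace := rfl

/-- The adjugate of `2 × 2` matrices as a continuous linear map. -/
noncomputable def adjL : M₂ →L[ℂ] M₂ :=
  traceL.smulRight (1 : M₂) - ContinuousLinearMap.id ℂ M₂

theorem adjL_apply (A : M₂) : adjL A = A.adjugate := by
  have : adjL A = A.trace • (1 : M₂) - A := rfl
  rw [this]
  ext i j
  fin_cases i <;> fin_cases j <;> simp [trace_fin_two, adjugate_fin_two]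

theorem adjL_mul (A B : M₂) : adjL (A * B) = adjL B * adjL A := by
  simp only [adjL_apply, adjugate_mul_distrib]

theorem adjL_eq_neg {A : M₂} (h : A.trace = 0) : adjL A = -A := by
  have : adjL A = A.trace • (1 : M₂) - A := rfl
  rw [this, h, zero_smul, zero_sub]

theorem mul_adjL (A : M₂) : A * adjL A = A.det • (1 : M₂) := by
  rw [adjL_apply, mul_adjugate]

/-- The coordinates of a `2 × 2` matrix modulo scalar matrices. -/
noncomputable def modScalarL : M₂ →L[ℂ] ℂ × ℂ × ℂ :=
  LinearMap.toContinuousLinearMap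
    { toFun := fun Y => (Y 0 1, Y 1 0, Y 0 0 - Y 1 1)
      map_add' := fun A B => by simp; ring
      map_smul' := fun c A => by simp; ring }

theorem modScalarL_apply (Y : M₂) : modScalarL Y = (Y 0 1, Y 1 0, Y 0 0 - Y 1 1) := rfl

/-- Nondegeneracy of the trace form on `sl₂`, tested on the standard basis. -/
theorem eq_zero_of_trace_mul_traceless {Z : M₂} (htr : Z.trace = 0)
    (h : ∀ X : M₂, X.trace = 0 → (Z * X).trace = 0) : Z = 0 := by
  have h1 := h !![0, 1; 0, 0] (by simp [trace_fin_two])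
  have h2 := h !![0, 0; 1, 0] (by simp [trace_fin_two])
  have h3 := h !![1, 0; 0, -1] (by simp [trace_fin_two])
  simp [trace_fin_two, mul_apply, Fin.sum_univ_two] at h1 h2 h3 htr
  ext i j
  fin_cases i <;> fin_cases j
  · simp; linear_combination (h3 + htr) / 2
  · simpa using h2
  · simpa using h1
  · simp; linear_combination (htr - h3) / 2

/-- A trace-free matrix orthogonal to the image of the differential of the commutator map at `(a, b)`
commutes with `a` and `b`. -/
theorem commute_of_orthogonal_commutator {a b : M₂ˣ} {ξ : M₂} (htr : ξ.trace = 0)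
    (hX : ∀ X : M₂, X.trace = 0 →
      (ξ * (X * a * b * (a⁻¹).val * (b⁻¹).val - a * b * ((a⁻¹).val * X) * (b⁻¹).val)
        * ((a * b * a⁻¹ * b⁻¹)⁻¹).val).trace = 0)
    (hY : ∀ Y : M₂, Y.trace = 0 →
      (ξ * (a * (Y * b) * (a⁻¹).val * (b⁻¹).val - a * b * (a⁻¹).val * ((b⁻¹).val * Y))
        * ((a * b * a⁻¹ * b⁻¹)⁻¹).val).trace = 0) :
    Commute ξ a ∧ Commute ξ b := by
  have cyc : ∀ (u : M₂ˣ) (x y : M₂), (x * (u * (y * (u⁻¹).val))).trace = ((u⁻¹).val * x * u * y).trace := by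
    intro u x y
    rw [← mul_assoc, ← mul_assoc, trace_mul_comm]
    simp only [mul_assoc]
  have trc : ∀ (u : M₂ˣ), ((u⁻¹).val * ξ * u).trace = 0 := by
    intro u
    rw [trace_mul_comm, ← mul_assoc, Units.mul_inv, one_mul, htr]
  have comm : ∀ (u : M₂ˣ), ξ = (u⁻¹).val * ξ * u → Commute ξ u := by
    intro u hu
    have : (u : M₂) * ξ = u * ((u⁻¹).val * ξ * u) := congrArg _ hu
    rw [mul_assoc, Units.mul_inv_cancel_left] at this
    exact this.symm
  -- The variation of `a` in `hX` simplifies to `X - h X h⁻¹` with `h = a b a⁻¹`. Orthogonality to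
  -- all of these says `ξ = h⁻¹ ξ h`.
  have h1 : Commute ξ ((a * b * a⁻¹ : M₂ˣ) : M₂) := by
    refine comm _ (sub_eq_zero.1 (eq_zero_of_trace_mul_traceless (by rw [trace_sub, htr, trc, sub_self]) ?_))
    intro X hX0
    rw [sub_mul, trace_sub, ← cyc, ← trace_sub]
    rw [← hX X hX0]
    congr 1
    simp [mul_assoc, mul_sub, sub_mul, -coe_units_inv]
  have h2 : Commute ξ ((a * b : M₂ˣ) : M₂) := by
    -- With `c = a b a⁻¹ b⁻¹`, the variation of `b` is `a Y a⁻¹ - c Y c⁻¹`, whence `a⁻¹ ξ a = c⁻¹ ξ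
    -- c`. As `ξ` commutes with `a b a⁻¹`, the right side is `b ξ b⁻¹`, so `ξ` commutes with `a b`.
    have h3 : ((a⁻¹).val * ξ * a : M₂) = ((a * b * a⁻¹ * b⁻¹)⁻¹).val * ξ * (a * b * a⁻¹ * b⁻¹).val := by
      refine sub_eq_zero.1 (eq_zero_of_trace_mul_traceless (by simp only [trace_sub, trc, sub_self])
        ?_)
      intro Y hY0
      rw [sub_mul, trace_sub, ← cyc, ← cyc, ← trace_sub]
      rw [← hY Y hY0]
      congr 1
      simp [mul_assoc, mul_sub, sub_mul, -coe_units_inv]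
    have h4 : (((a * b * a⁻¹ * b⁻¹)⁻¹).val * ξ * (a * b * a⁻¹ * b⁻¹).val : M₂) = b * ξ * (b⁻¹).val := by
      have h5 : ((a * b * a⁻¹ * b⁻¹ : M₂ˣ) : M₂) = (a * b * a⁻¹).val * (b⁻¹).val := by simp
      have h6 : (((a * b * a⁻¹ * b⁻¹)⁻¹ : M₂ˣ) : M₂) = b * ((a * b * a⁻¹)⁻¹).val := by
        simp [mul_assoc]
      rw [h5, h6, mul_assoc, ← mul_assoc ξ, h1.eq]
      simp only [mul_assoc, Units.inv_mul_cancel_left]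
    rw [h4] at h3
    have h7 : (a * ((a⁻¹).val * ξ * a) * b : M₂) = a * (b * ξ * (b⁻¹).val) * b := by rw [h3]
    simp only [mul_assoc, Units.mul_inv_cancel_left, Units.inv_mul, mul_one] at h7
    change ξ * (a * b).val = (a * b).val * ξ
    simpa [mul_assoc] using h7
  have ha : Commute ξ a := by
    have : (a : M₂) = ((a * b * a⁻¹)⁻¹).val * (a * b).val := by simp [mul_assoc]
    rw [this]
    exact (h1.units_inv_right).mul_right h2
  refine ⟨ha, ?_⟩
  have : (b : M₂) = (a⁻¹).val * (a * b).val := by simp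
  rw [this]
  exact (ha.units_inv_right).mul_right h2

variable {g : ℕ}

/-- The polynomial extension of the commutator `[aᵢ, bᵢ]` to all tuples of matrices. -/
noncomputable def commMat (i : Fin g) (e : Fin g ⊕ Fin g → M₂) : M₂ :=
  e (Sum.inl i) * e (Sum.inr i) * adjL (e (Sum.inl i)) * adjL (e (Sum.inr i))

/-- The polynomial extension of the product of commutators over a list of indices. -/
noncomputable def relMat (L : List (Fin g)) (e : Fin g ⊕ Fin g → M₂) : M₂ :=
  (L.map fun i => commMat i e).prod

theorem contDiff_commMat (i : Fin g) : ContDiff ℂ ω (commMat i) := by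
  have h : ∀ k : Fin g ⊕ Fin g, ContDiff ℂ ω fun e : Fin g ⊕ Fin g → M₂ => e k :=
    fun k => contDiff_apply ℂ M₂ k
  exact (((h _).mul (h _)).mul (adjL.contDiff.comp (h _))).mul (adjL.contDiff.comp (h _))

theorem contDiff_relMat (L : List (Fin g)) : ContDiff ℂ ω (relMat L) := by
  induction L with
  | nil => exact contDiff_const
  | cons i L ih => exact (contDiff_commMat i).mul ih

theorem fderiv_commMat (i : Fin g) (e v : Fin g ⊕ Fin g → M₂) :
    fderiv ℂ (commMat i) e v =
      v (Sum.inl i) * e (Sum.inr i) * adjL (e (Sum.inl i)) * adjL (e (Sum.inr i))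
      + e (Sum.inl i) * v (Sum.inr i) * adjL (e (Sum.inl i)) * adjL (e (Sum.inr i))
      + e (Sum.inl i) * e (Sum.inr i) * adjL (v (Sum.inl i)) * adjL (e (Sum.inr i))
      + e (Sum.inl i) * e (Sum.inr i) * adjL (e (Sum.inl i)) * adjL (v (Sum.inr i)) := by
  have h : ∀ k : Fin g ⊕ Fin g, HasFDerivAt (fun e : Fin g ⊕ Fin g → M₂ => e k)
      (ContinuousLinearMap.proj (R := ℂ) k) e := fun k => hasFDerivAt_apply k e
  have h' : ∀ k : Fin g ⊕ Fin g, HasFDerivAt (fun e : Fin g ⊕ Fin g → M₂ => adjL (e k))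
      (adjL.comp (ContinuousLinearMap.proj (R := ℂ) k)) e :=
    fun k => adjL.hasFDerivAt.comp e (h k)
  have key : HasFDerivAt (commMat i) _ e :=
    (((h (Sum.inl i)).mul' (h (Sum.inr i))).mul' (h' (Sum.inl i))).mul' (h' (Sum.inr i))
  rw [key.fderiv]
  change e (Sum.inl i) * e (Sum.inr i) * adjL (e (Sum.inl i)) * adjL (v (Sum.inr i)) +
    (e (Sum.inl i) * e (Sum.inr i) * adjL (v (Sum.inl i)) +
      (e (Sum.inl i) * v (Sum.inr i) + v (Sum.inl i) * e (Sum.inr i)) * adjL (e (Sum.inl i)))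
      * adjL (e (Sum.inr i)) = _
  noncomm_ring

theorem fderiv_relMat_cons (i : Fin g) (L : List (Fin g)) (e v : Fin g ⊕ Fin g → M₂) :
    fderiv ℂ (relMat (i :: L)) e v =
      commMat i e * fderiv ℂ (relMat L) e v + fderiv ℂ (commMat i) e v * relMat L e := by
  have h1 := ((contDiff_commMat i).differentiable (by simp) e).hasFDerivAt
  have h2 := ((contDiff_relMat L).differentiable (by simp) e).hasFDerivAt
  have key : HasFDerivAt (relMat (i :: L)) _ e := h1.mul' h2
  rw [key.fderiv]
  rfl

/-- `relMat L` involves only the letters indexed by `L`. This separates the first commutator from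
the others when the indices are distinct. -/
theorem fderiv_relMat_eq_zero (L : List (Fin g)) (e v : Fin g ⊕ Fin g → M₂)
    (h : ∀ i ∈ L, v (Sum.inl i) = 0 ∧ v (Sum.inr i) = 0) : fderiv ℂ (relMat L) e v = 0 := by
  induction L with
  | nil =>
    have : relMat ([] : List (Fin g)) = fun _ => (1 : M₂) := rfl
    rw [this]; simp
  | cons i L ih =>
    obtain ⟨h1, h2⟩ := h i (by simp)
    rw [fderiv_relMat_cons, ih fun j hj => h j (by simp [hj]), fderiv_commMat, h1, h2]
    simp

/-- The product of commutators of units over a list of indices. -/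
def relUnit (L : List (Fin g)) (u : Fin g ⊕ Fin g → M₂ˣ) : M₂ˣ :=
  (L.map fun i => u (Sum.inl i) * u (Sum.inr i) * (u (Sum.inl i))⁻¹ * (u (Sum.inr i))⁻¹).prod

theorem relMat_coe (L : List (Fin g)) {u : Fin g ⊕ Fin g → M₂ˣ}
    (hu : ∀ k, adjL (u k : M₂) = ((u k)⁻¹).val) : relMat L (fun k => (u k : M₂)) = relUnit L u := by
  induction L with
  | nil => rfl
  | cons i L ih =>
    have h1 : relMat (i :: L) (fun k => (u k : M₂))
      = commMat i (fun k => (u k : M₂)) * relMat L (fun k => (u k : M₂)) := rfl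
    have h2 : relUnit (i :: L) u
      = (u (Sum.inl i) * u (Sum.inr i) * (u (Sum.inl i))⁻¹ * (u (Sum.inr i))⁻¹) * relUnit L u := rfl
    rw [h1, h2, ih]
    simp [commMat, hu]

/-- A trace-free matrix orthogonal to the image of the differential of the product of commutators
commutes with all entries of the tuple. -/
theorem commute_of_orthogonal_relMat {L : List (Fin g)} (hL : L.Nodup)
    {u : Fin g ⊕ Fin g → M₂ˣ} (hu : ∀ k, adjL (u k : M₂) = ((u k)⁻¹).val)
    {ξ : M₂} (htr : ξ.trace = 0)
    (h : ∀ k X, X.trace = 0 →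
      (ξ * fderiv ℂ (relMat L) (fun k => (u k : M₂)) (Pi.single k (X * u k)) * ((relUnit L u)⁻¹).val).trace
        = 0) :
    ∀ i ∈ L, Commute ξ (u (Sum.inl i) : M₂) ∧ Commute ξ (u (Sum.inr i) : M₂) := by
  induction L with
  | nil => simp
  | cons i L ih =>
    obtain ⟨hi, hL⟩ := List.nodup_cons.1 hL
    set c : M₂ˣ := u (Sum.inl i) * u (Sum.inr i) * (u (Sum.inl i))⁻¹ * (u (Sum.inr i))⁻¹ with hc
    have hcu : relUnit (i :: L) u = c * relUnit L u := rfl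
    have hcm : commMat i (fun k => (u k : M₂)) = c := by simp [commMat, hu, hc]
    -- Product rule, translated back to the identity: the variation of the tail appears conjugated
    -- by `c`, next to that of the first commutator.
    have h' : ∀ k X, X.trace = 0 →
        (ξ * c * (fderiv ℂ (relMat L) (fun k => (u k : M₂)) (Pi.single k (X * u k))
          * ((relUnit L u)⁻¹).val) * (c⁻¹).val).trace
        + (ξ * fderiv ℂ (commMat i) (fun k => (u k : M₂)) (Pi.single k (X * u k)) * (c⁻¹).val).trace
        = 0 := by
      intro k X hX
      rw [← h k X hX, fderiv_relMat_cons, hcm, hcu, relMat_coe L hu, ← trace_add]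
      congr 1
      simp [mul_add, add_mul, mul_assoc]
    have hadj : ∀ k (X : M₂), X.trace = 0 → adjL (X * u k) = -(((u k)⁻¹).val * X) := by
      intro k X hX
      rw [adjL_mul, hu, adjL_eq_neg hX, mul_neg]
    have hzero : ∀ k, (k = Sum.inl i ∨ k = Sum.inr i) → ∀ X : M₂,
        fderiv ℂ (relMat L) (fun k => (u k : M₂)) (Pi.single k (X * u k)) = 0 := by
      intro k hk X
      apply fderiv_relMat_eq_zero
      intro j hj
      have hji : j ≠ i := fun h => hi (h ▸ hj)
      rcases hk with rfl | rfl <;> simp [hji]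
    have hcomm : Commute ξ (u (Sum.inl i) : M₂) ∧ Commute ξ (u (Sum.inr i) : M₂) := by
      refine commute_of_orthogonal_commutator htr (fun X hX => ?_) fun X hX => ?_
      · have := h' (Sum.inl i) X hX
        rw [hzero _ (Or.inl rfl), fderiv_commMat] at this
        simp only [Pi.single_eq_same, hu, hadj _ X hX, Pi.single_eq_of_ne, ne_eq, reduceCtorEq,
          not_false_eq_true, map_zero, mul_zero, zero_mul, add_zero, zero_add, trace_zero] at this
        rw [← this]
        congr 3
        noncomm_ring
      · have := h' (Sum.inr i) X hX
        rw [hzero _ (Or.inr rfl), fderiv_commMat] at this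
        simp only [Pi.single_eq_same, hu, hadj _ X hX, Pi.single_eq_of_ne, ne_eq, reduceCtorEq,
          not_false_eq_true, map_zero, mul_zero, zero_mul, add_zero, zero_add, trace_zero] at this
        rw [← this]
        congr 3
        noncomm_ring
    -- Once `ξ` commutes with `c`, the conjugation by `c` disappears from the trace and the
    -- induction hypothesis applies to the tail.
    have hcc : Commute ξ (c : M₂) := by
      have h1 := hcomm.1
      have h2 := hcomm.2
      have := ((h1.mul_right h2).mul_right h1.units_inv_right).mul_right h2.units_inv_right
      simpa [hc] using this
    intro j hj
    rcases List.mem_cons.1 hj with rfl | hj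
    · exact hcomm
    refine ih hL (fun k X hX => ?_) j hj
    by_cases hk : k = Sum.inl i ∨ k = Sum.inr i
    · rw [hzero k hk]; simp
    · push Not at hk
      have h1 := h' k X hX
      rw [fderiv_commMat] at h1
      simp only [Pi.single_eq_of_ne hk.1.symm, Pi.single_eq_of_ne hk.2.symm, map_zero, mul_zero,
        zero_mul, add_zero, trace_zero] at h1
      rw [hcc.eq, trace_mul_comm] at h1
      simpa [mul_assoc] using h1

/-- The equations of the representation variety: determinants, and the relator modulo scalars. -/
noncomputable def repEquations (e : Fin g ⊕ Fin g → M₂) : (Fin g ⊕ Fin g → ℂ) × (ℂ × ℂ × ℂ) :=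
  (fun k => traceL (e k * adjL (e k)), modScalarL (relMat (List.finRange g) e))

theorem contDiff_repEquations : ContDiff ℂ ω (repEquations (g := g)) := by
  refine ContDiff.prodMk (contDiff_pi.2 fun k => ?_)
    (modScalarL.contDiff.comp (contDiff_relMat _))
  have h : ContDiff ℂ ω fun e : Fin g ⊕ Fin g → M₂ => e k := contDiff_apply ℂ M₂ k
  exact traceL.contDiff.comp (h.mul (adjL.contDiff.comp h))

theorem fderiv_repEquations (e v : Fin g ⊕ Fin g → M₂) :
    fderiv ℂ repEquations e v = (fun k => (e k * adjL (v k) + v k * adjL (e k)).trace,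
      modScalarL (fderiv ℂ (relMat (List.finRange g)) e v)) := by
  have h : ∀ k : Fin g ⊕ Fin g, HasFDerivAt (fun e : Fin g ⊕ Fin g → M₂ => e k)
      (ContinuousLinearMap.proj (R := ℂ) k) e := fun k => hasFDerivAt_apply k e
  have h1 : ∀ k : Fin g ⊕ Fin g, HasFDerivAt
      (fun e : Fin g ⊕ Fin g → M₂ => traceL (e k * adjL (e k))) _ e :=
    fun k => traceL.hasFDerivAt.comp e ((h k).mul' (adjL.hasFDerivAt.comp e (h k)))
  have h2 := ((contDiff_relMat (List.finRange g)).differentiable (by simp) e).hasFDerivAt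
  have h3 : HasFDerivAt repEquations _ e :=
    (hasFDerivAt_pi.2 h1).prodMk (modScalarL.hasFDerivAt.comp e h2)
  rw [h3.fderiv]
  exact Prod.ext (funext fun k => rfl) rfl

/-- At a tuple with trivial trace-free centralizer that satisfies the surface relation, the
equations of the representation variety define a submersion. -/
theorem surjective_fderiv_repEquations {u : Fin g ⊕ Fin g → M₂ˣ}
    (hu : ∀ k, adjL (u k : M₂) = ((u k)⁻¹).val) (hrel : relUnit (List.finRange g) u = 1)
    (hirr : ∀ ξ : M₂, ξ.trace = 0 → (∀ k, Commute ξ (u k : M₂)) → ξ = 0) :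
    Function.Surjective (fderiv ℂ repEquations fun k => (u k : M₂)) := by
  set e : Fin g ⊕ Fin g → M₂ := fun k => (u k : M₂) with he
  let d : (Fin g ⊕ Fin g → M₂) →ₗ[ℂ] (Fin g ⊕ Fin g → ℂ) :=
    LinearMap.fst ℂ _ _ ∘ₗ (fderiv ℂ repEquations e).toLinearMap
  let t : (Fin g ⊕ Fin g → M₂) →ₗ[ℂ] (ℂ × ℂ × ℂ) :=
    LinearMap.snd ℂ _ _ ∘ₗ (fderiv ℂ repEquations e).toLinearMap
  have hd : ∀ v k, d v k = (e k * adjL (v k) + v k * adjL (e k)).trace := by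
    intro v k
    simp [d, fderiv_repEquations]
  have ht : ∀ v, t v = modScalarL (fderiv ℂ (relMat (List.finRange g)) e v) := by
    intro v
    simp [t, fderiv_repEquations]
  have hmem : ∀ k (X : M₂), X.trace = 0 → Pi.single k (X * u k) ∈ LinearMap.ker d := by
    intro k X hX
    rw [LinearMap.mem_ker]
    funext j
    rw [hd]
    by_cases hj : j = k
    · subst hj
      simp [adjL_mul, hu, he, adjL_eq_neg hX, mul_assoc]
    · simp [hj]
  -- The relator equations are already independent along directions that preserve the determinants;
  -- the determinants are adjusted afterwards.
  have hker : (t.comp (LinearMap.ker d).subtype).range = ⊤ := by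
    by_contra hne
    obtain ⟨ℓ, hℓ, hle⟩ := Submodule.exists_le_ker_of_lt_top _ (lt_top_iff_ne_top.2 hne)
    have hℓ' : ∀ y : ℂ × ℂ × ℂ, ℓ y = y.1 * ℓ (1, 0, 0) + y.2.1 * ℓ (0, 1, 0)
        + y.2.2 * ℓ (0, 0, 1) := by
      intro y
      rw [← smul_eq_mul, ← smul_eq_mul, ← smul_eq_mul, ← map_smul, ← map_smul, ← map_smul,
        ← map_add, ← map_add]
      simp
    -- The trace form identifies functionals on matrices modulo scalars with trace-free matrices;
    -- `ξ` represents `ℓ`.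
    set ξ : M₂ := !![ℓ (0, 0, 1), ℓ (0, 1, 0); ℓ (1, 0, 0), -ℓ (0, 0, 1)] with hξ
    have hξℓ : ∀ Y : M₂, (ξ * Y).trace = ℓ (modScalarL Y) := by
      intro Y
      rw [hℓ', modScalarL_apply, trace_fin_two, mul_apply, mul_apply, Fin.sum_univ_two,
        Fin.sum_univ_two]
      simp [hξ]
      ring
    have hξtr : ξ.trace = 0 := by simp [hξ, trace_fin_two]
    have hξ0 : ξ = 0 := by
      have hcomm := commute_of_orthogonal_relMat (List.nodup_finRange g) hu hξtr (fun k X hX => by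
        rw [hrel, inv_one, Units.val_one, mul_one, hξℓ, ← ht]
        exact hle ⟨⟨_, hmem k X hX⟩, rfl⟩)
      refine hirr ξ hξtr fun k => ?_
      rcases k with i | i
      · exact (hcomm i (List.mem_finRange i)).1
      · exact (hcomm i (List.mem_finRange i)).2
    refine hℓ (LinearMap.ext fun y => ?_)
    have e1 := congrFun (congrFun hξ0 0) 0
    have e2 := congrFun (congrFun hξ0 0) 1
    have e3 := congrFun (congrFun hξ0 1) 0
    simp [hξ] at e1 e2 e3
    rw [hℓ', e1, e2, e3]
    simp
  intro y
  -- Rescaling `e k` to first order by `s` changes `tr (e k * adjL (e k)) = 2 det (e k)` by `4 s`,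
  -- as `det (e k) = 1`.
  let v₀ : Fin g ⊕ Fin g → M₂ := fun k => (y.1 k / 4) • e k
  have hv₀ : d v₀ = y.1 := by
    funext k
    rw [hd]
    simp [v₀, he, hu, trace_add]
    ring
  obtain ⟨w, hw⟩ := LinearMap.range_eq_top.1 hker (y.2 - t v₀)
  have hw1 : d w = 0 := w.2
  have hw2 : t w = y.2 - t v₀ := hw
  refine ⟨v₀ + w, Prod.ext ?_ ?_⟩
  · change d (v₀ + w) = y.1
    rw [map_add, hv₀, hw1, add_zero]
  · change t (v₀ + w) = y.2
    rw [map_add, hw2]; abel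

end RelatorMap

/-! ### Traces as a submersion on tuples of matrices -/

section TraceSection

open Matrix
open scoped Matrix.Norms.Operator

theorem trace_mul_adjL (A : M₂) : (A * adjL A).trace = 2 * A.det := by
  rw [mul_adjL, trace_smul, trace_one]; simp [mul_comm]

theorem trace_mul_adjL_polar (A B : M₂) :
    (A * adjL B + B * adjL A).trace = 2 * (A.trace * B.trace - (B * A).trace) := by
  have h : ∀ X : M₂, adjL X = X.trace • (1 : M₂) - X := fun X => rfl
  rw [h, h, trace_add, mul_sub, mul_sub, trace_sub, trace_sub, trace_mul_comm A B]
  simp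
  ring

/-- Makes the nondegeneracy of a pair a condition on traces and determinants: it is open on
characters and passes to any unimodular pair with the same traces. -/
theorem det_commutator_eq (a b : M₂) :
    (a * b - b * a).det = 4 * a.det * b.det - a.trace ^ 2 * b.det - b.trace ^ 2 * a.det
      - (a * b).trace ^ 2 + a.trace * b.trace * (a * b).trace := by
  simp [det_fin_two, trace_fin_two, mul_apply, Fin.sum_univ_two]
  ring

/-- The traces of a matrix against `1, a, b, a * b`. -/
noncomputable def traceQuad (a b : M₂) : M₂ →ₗ[ℂ] ℂ × ℂ × ℂ × ℂ where
  toFun N := (N.trace, (N * a).trace, (N * b).trace, (N * (a * b)).trace)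
  map_add' := fun X Y => by simp [add_mul]
  map_smul' := fun c X => by simp

theorem traceQuad_injective {a b : M₂} (h : (a * b - b * a).det ≠ 0) :
    Function.Injective (traceQuad a b) := by
  rw [← LinearMap.ker_eq_bot, LinearMap.ker_eq_bot']
  intro N hN
  simp only [traceQuad, LinearMap.coe_mk, AddHom.coe_mk, Prod.mk_eq_zero] at hN
  exact eq_zero_of_trace_mul_eq_zero h hN.1 hN.2.1 hN.2.2.1 hN.2.2.2

theorem traceQuad_surjective {a b : M₂} (h : (a * b - b * a).det ≠ 0) :
    Function.Surjective (traceQuad a b) := by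
  refine (LinearMap.injective_iff_surjective_of_finrank_eq_finrank ?_).1 (traceQuad_injective h)
  simp [Module.finrank_matrix]

variable {ι : Type*} [Fintype ι]

/-- Trace invariants of a pair of matrices and a further tuple of matrices. -/
noncomputable def traceData (w : (M₂ × M₂) × (ι → M₂)) :
    (ℂ × ℂ × ℂ × ℂ × ℂ) × (ι → ℂ × ℂ × ℂ × ℂ) :=
  ((traceL (w.1.1 * adjL w.1.1), traceL w.1.1, traceL (w.1.2 * adjL w.1.2), traceL w.1.2,
    traceL (w.1.1 * w.1.2)),
    fun k => (traceL (w.2 k), traceL (w.2 k * w.1.1), traceL (w.2 k * w.1.2),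
      traceL (w.2 k * (w.1.1 * w.1.2))))

theorem contDiff_traceData : ContDiff ℂ ω (traceData (ι := ι)) := by
  have hA : ContDiff ℂ ω fun w : (M₂ × M₂) × (ι → M₂) => w.1.1 := contDiff_fst.fst
  have hB : ContDiff ℂ ω fun w : (M₂ × M₂) × (ι → M₂) => w.1.2 := contDiff_fst.snd
  have hm : ∀ k, ContDiff ℂ ω fun w : (M₂ × M₂) × (ι → M₂) => w.2 k :=
    fun k => (contDiff_apply ℂ M₂ k).comp contDiff_snd
  have ht : ∀ {F : (M₂ × M₂) × (ι → M₂) → M₂}, ContDiff ℂ ω F → ContDiff ℂ ω fun w => traceL (F w) :=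
    fun hF => traceL.contDiff.comp hF
  exact ((ht (hA.mul (adjL.contDiff.comp hA))).prodMk ((ht hA).prodMk
    ((ht (hB.mul (adjL.contDiff.comp hB))).prodMk ((ht hB).prodMk (ht (hA.mul hB)))))).prodMk
    (contDiff_pi.2 fun k => (ht (hm k)).prodMk ((ht ((hm k).mul hA)).prodMk
      ((ht ((hm k).mul hB)).prodMk (ht ((hm k).mul (hA.mul hB))))))

theorem fderiv_traceData (w v : (M₂ × M₂) × (ι → M₂)) :
    fderiv ℂ traceData w v =
      (((w.1.1 * adjL v.1.1 + v.1.1 * adjL w.1.1).trace, v.1.1.trace,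
        (w.1.2 * adjL v.1.2 + v.1.2 * adjL w.1.2).trace, v.1.2.trace,
        (w.1.1 * v.1.2 + v.1.1 * w.1.2).trace),
      fun k => ((v.2 k).trace, (w.2 k * v.1.1 + v.2 k * w.1.1).trace,
        (w.2 k * v.1.2 + v.2 k * w.1.2).trace,
        (w.2 k * (w.1.1 * v.1.2 + v.1.1 * w.1.2) + v.2 k * (w.1.1 * w.1.2)).trace)) := by
  have hA : HasFDerivAt (fun w : (M₂ × M₂) × (ι → M₂) => w.1.1) _ w :=
    ((ContinuousLinearMap.fst ℂ M₂ M₂).comp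
      (ContinuousLinearMap.fst ℂ (M₂ × M₂) (ι → M₂))).hasFDerivAt
  have hB : HasFDerivAt (fun w : (M₂ × M₂) × (ι → M₂) => w.1.2) _ w :=
    ((ContinuousLinearMap.snd ℂ M₂ M₂).comp
      (ContinuousLinearMap.fst ℂ (M₂ × M₂) (ι → M₂))).hasFDerivAt
  have hm : ∀ k, HasFDerivAt (fun w : (M₂ × M₂) × (ι → M₂) => w.2 k) _ w :=
    fun k => ((ContinuousLinearMap.proj (R := ℂ) (φ := fun _ : ι => M₂) k).comp
      (ContinuousLinearMap.snd ℂ (M₂ × M₂) (ι → M₂))).hasFDerivAt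
  have ht : ∀ {F : (M₂ × M₂) × (ι → M₂) → M₂} {F'}, HasFDerivAt F F' w →
      HasFDerivAt (fun w => traceL (F w)) (traceL.comp F') w :=
    fun hF => traceL.hasFDerivAt.comp w hF
  have ha : ∀ {F : (M₂ × M₂) × (ι → M₂) → M₂} {F'}, HasFDerivAt F F' w →
      HasFDerivAt (fun w => adjL (F w)) (adjL.comp F') w :=
    fun hF => adjL.hasFDerivAt.comp w hF
  have key : HasFDerivAt traceData _ w :=
    ((ht (hA.mul' (ha hA))).prodMk ((ht hA).prodMk
    ((ht (hB.mul' (ha hB))).prodMk ((ht hB).prodMk (ht (hA.mul' hB)))))).prodMk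
    (hasFDerivAt_pi.2 fun k => (ht (hm k)).prodMk ((ht ((hm k).mul' hA)).prodMk
      ((ht ((hm k).mul' hB)).prodMk (ht ((hm k).mul' (hA.mul' hB))))))
  rw [key.fderiv]
  rfl

/-- The trace invariants define a submersion where the pair has no common eigenvector. -/
theorem surjective_fderiv_traceData {w : (M₂ × M₂) × (ι → M₂)}
    (h : (w.1.1 * w.1.2 - w.1.2 * w.1.1).det ≠ 0) : Function.Surjective (fderiv ℂ traceData w) := by
  obtain ⟨⟨a, b⟩, m⟩ := w
  dsimp only at h
  have hsurj : ∀ p : ℂ × ℂ × ℂ × ℂ, ∃ N : M₂, N.trace = p.1 ∧ (N * a).trace = p.2.1 ∧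
      (N * b).trace = p.2.2.1 ∧ (N * (a * b)).trace = p.2.2.2 := by
    intro p
    obtain ⟨N, rfl⟩ := traceQuad_surjective h p
    exact ⟨N, rfl, rfl, rfl, rfl⟩
  rintro ⟨⟨p1, p2, p3, p4, p5⟩, y⟩
  -- The second entry solves `2 (tr a · tr a' - tr (a' a)) = p1`, the variation of `2 det a`;
  -- likewise for `b'`. All of `p5` is assigned to `tr (a' b)`, so `tr (b' a) = 0`; the last entries
  -- are free. Each `m'` then compensates for the terms in `a'` and `b'`.
  obtain ⟨a', ha1, ha2, ha3, -⟩ := hsurj (p2, a.trace * p2 - p1 / 2, p5, 0)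
  obtain ⟨b', hb1, hb2, hb3, -⟩ := hsurj (p4, 0, b.trace * p4 - p3 / 2, 0)
  choose m' hm1 hm2 hm3 hm4 using fun k => hsurj ((y k).1, (y k).2.1 - (m k * a').trace,
    (y k).2.2.1 - (m k * b').trace, (y k).2.2.2 - (m k * (a * b' + a' * b)).trace)
  refine ⟨((a', b'), m'), ?_⟩
  rw [fderiv_traceData]
  dsimp only at *
  simp only [trace_mul_adjL_polar, ha1, ha2, hb1, hb3, hm1]
  refine Prod.ext (Prod.ext ?_ (Prod.ext rfl (Prod.ext ?_ (Prod.ext rfl ?_)))) ?_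
  · dsimp only; ring
  · dsimp only; ring
  · dsimp only
    rw [trace_add, trace_mul_comm a b', hb2, ha3, zero_add]
  · funext k
    refine Prod.ext rfl (Prod.ext ?_ (Prod.ext ?_ ?_))
    · dsimp only; rw [trace_add, hm2]; ring
    · dsimp only; rw [trace_add, hm3]; ring
    · dsimp only; rw [trace_add, hm4]; ring

end TraceSection

/-! ### Representations and characters of surface groups -/

section SurfaceGroup

open Matrix
open scoped Matrix.Norms.Operator

theorem SpecialLinearGroup.coe_mul_two (a b : SL(2, ℂ)) :
    ((a * b : SL(2, ℂ)) : M₂) = (a : M₂) * (b : M₂) := rfl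

theorem SpecialLinearGroup.coe_inv_eq_adjL (a : SL(2, ℂ)) :
    ((a⁻¹ : SL(2, ℂ)) : M₂) = adjL (a : M₂) := by
  rw [adjL_apply]; rfl

theorem trace_conj_two (P a : SL(2, ℂ)) :
    ((P * a * P⁻¹ : SL(2, ℂ)) : M₂).trace = (a : M₂).trace := by
  change ((P * a : SL(2, ℂ)) * (P⁻¹ : SL(2, ℂ)) : M₂).trace = _
  rw [trace_mul_comm]
  change (((P⁻¹ * (P * a)) : SL(2, ℂ)) : M₂).trace = _
  rw [inv_mul_cancel_left]

section Words

variable {ι : Type*}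

/-- The polynomial extension of evaluation of a word to all tuples of matrices. -/
noncomputable def wordMat (L : List (ι × Bool)) (e : ι → M₂) : M₂ :=
  (L.map fun x => bif x.2 then e x.1 else adjL (e x.1)).prod

theorem contDiff_wordMat [Fintype ι] (L : List (ι × Bool)) : ContDiff ℂ ω (wordMat L) := by
  induction L with
  | nil => exact contDiff_const
  | cons x L ih =>
    have h : ContDiff ℂ ω fun e : ι → M₂ => bif x.2 then e x.1 else adjL (e x.1) := by
      have h1 : ContDiff ℂ ω fun e : ι → M₂ => e x.1 := contDiff_apply ℂ M₂ x.1
      cases x.2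
      · exact adjL.contDiff.comp h1
      · exact h1
    exact h.mul ih

theorem wordMat_coe (L : List (ι × Bool)) (u : ι → SL(2, ℂ)) :
    wordMat L (fun k => (u k : M₂)) = (FreeGroup.lift u (FreeGroup.mk L) : M₂) := by
  rw [FreeGroup.lift_mk]
  induction L with
  | nil => rfl
  | cons x L ih =>
    have h1 : wordMat (x :: L) (fun k => (u k : M₂))
      = (bif x.2 then (u x.1 : M₂) else adjL (u x.1 : M₂)) * wordMat L (fun k => (u k : M₂)) := rfl
    rw [h1, ih, List.map_cons, List.prod_cons]
    rw [SpecialLinearGroup.coe_mul_two]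
    cases x.2
    · simp only [cond_false, SpecialLinearGroup.coe_inv_eq_adjL]
    · rfl

end Words

variable {g : ℕ}

theorem relMat_coe_lift (u : Fin g ⊕ Fin g → SL(2, ℂ)) :
    relMat (List.finRange g) (fun k => (u k : M₂)) = (FreeGroup.lift u (surfaceRelator g) : M₂) := by
  unfold surfaceRelator
  induction List.finRange g with
  | nil => simp [relMat]
  | cons i L ih =>
    have h1 : relMat (i :: L) (fun k => (u k : M₂))
      = commMat i (fun k => (u k : M₂)) * relMat L (fun k => (u k : M₂)) := rfl
    rw [h1, ih, List.map_cons, List.prod_cons, map_mul, SpecialLinearGroup.coe_mul_two]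
    simp [commMat, adjL_apply]

theorem eq_coe_of_trace_mul_adjL {A : M₂} (h : (A * adjL A).trace = 2) :
    ∃ u : SL(2, ℂ), A = (u : M₂) := by
  rw [trace_mul_adjL] at h
  exact ⟨⟨A, by linear_combination h / 2⟩, rfl⟩

theorem repEquations_coe {u : Fin g ⊕ Fin g → SL(2, ℂ)}
    (hu : FreeGroup.lift u (surfaceRelator g) = 1) :
    repEquations (fun k => (u k : M₂)) = (fun _ => 2, 0) := by
  refine Prod.ext (funext fun k => ?_) ?_
  · change ((u k : M₂) * adjL (u k : M₂)).trace = 2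
    rw [trace_mul_adjL, (u k).2, mul_one]
  · change modScalarL (relMat _ _) = 0
    rw [relMat_coe_lift, hu, modScalarL_apply]
    simp

/-- Near a representation, the equations cut out the representation variety. -/
theorem exists_of_repEquations_eq {e : Fin g ⊕ Fin g → M₂}
    (he : repEquations e = (fun _ => 2, 0)) (hne : relMat (List.finRange g) e 0 0 ≠ -1) :
    ∃ u : Fin g ⊕ Fin g → SL(2, ℂ), e = (fun k => (u k : M₂)) ∧
      FreeGroup.lift u (surfaceRelator g) = 1 := by
  have h1 : ∀ k, (e k * adjL (e k)).trace = 2 := fun k => congrFun (congrArg Prod.fst he) k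
  have h2 : modScalarL (relMat (List.finRange g) e) = 0 := congrArg Prod.snd he
  choose u hu using fun k => eq_coe_of_trace_mul_adjL (h1 k)
  obtain rfl : e = fun k => (u k : M₂) := funext hu
  refine ⟨u, rfl, ?_⟩
  rw [relMat_coe_lift] at h2 hne
  generalize FreeGroup.lift u (surfaceRelator g) = R at h2 hne
  have hdet : (R : M₂) 0 0 * (R : M₂) 1 1 - (R : M₂) 0 1 * (R : M₂) 1 0 = 1 := by
    rw [← det_fin_two]; exact R.2
  rw [modScalarL_apply] at h2
  simp only [Prod.mk_eq_zero] at h2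
  obtain ⟨e1, e2, e3⟩ := h2
  -- A scalar matrix of determinant 1 is `1` or `-1`; the hypothesis `hne` rules out `-1`.
  have h4 : ((R : M₂) 0 0 - 1) * ((R : M₂) 0 0 + 1) = 0 := by
    linear_combination hdet + (R : M₂) 0 0 * e3 + (R : M₂) 1 0 * e1
  have h5 : (R : M₂) 0 0 = 1 := by
    rcases mul_eq_zero.1 h4 with h | h
    · linear_combination h
    · exact absurd (by linear_combination h) hne
  have h6 : (R : M₂) 1 1 = 1 := by linear_combination h5 - e3
  apply Subtype.ext
  ext i j
  fin_cases i <;> fin_cases j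
  · exact h5
  · exact e1
  · exact e2
  · exact h6

/-- The presentation of a surface group, with its universal property for `SL(2, ℂ)`. -/
theorem IsSurfaceGroup.exists_presentation {Γ : Type*} [Group Γ] (hΓ : IsSurfaceGroup g Γ) :
    ∃ π : FreeGroup (Fin g ⊕ Fin g) →* Γ, Function.Surjective π ∧ π (surfaceRelator g) = 1 ∧
      ∀ u : Fin g ⊕ Fin g → SL(2, ℂ), FreeGroup.lift u (surfaceRelator g) = 1 →
        ∃ ρ : Γ →* SL(2, ℂ), ∀ k, ρ (π (FreeGroup.of k)) = u k := by
  obtain ⟨φ⟩ := hΓ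
  refine ⟨φ.symm.toMonoidHom.comp (PresentedGroup.mk _), ?_, ?_, ?_⟩
  · exact φ.symm.surjective.comp (PresentedGroup.mk_surjective _)
  · have : PresentedGroup.mk {surfaceRelator g} (surfaceRelator g) = 1 :=
      PresentedGroup.one_of_mem rfl
    simp [this]
  · intro u hu
    have hu' : ∀ r ∈ ({surfaceRelator g} : Set _), FreeGroup.lift u r = 1 := by
      rintro r rfl; exact hu
    refine ⟨(PresentedGroup.toGroup hu').comp φ.toMonoidHom, fun k => ?_⟩
    have h : φ (φ.symm (PresentedGroup.mk {surfaceRelator g} (FreeGroup.of k)))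
      = PresentedGroup.of k := φ.apply_symm_apply _
    simp [h]

/-- The representation variety of a surface group has a local analytic retraction near an irreducible
representation. -/
theorem exists_retraction_repVariety {Γ : Type*} [Group Γ] {π : FreeGroup (Fin g ⊕ Fin g) →* Γ}
    (hπ : Function.Surjective π) (hrel : π (surfaceRelator g) = 1)
    (huniv : ∀ u : Fin g ⊕ Fin g → SL(2, ℂ), FreeGroup.lift u (surfaceRelator g) = 1 →
        ∃ ρ : Γ →* SL(2, ℂ), ∀ k, ρ (π (FreeGroup.of k)) = u k)
    {ρ₀ : Γ →* SL(2, ℂ)} (hρ₀ : IsIrreducibleRep ρ₀) {e₀ : Fin g ⊕ Fin g → M₂}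
    (he₀ : e₀ = fun k => (ρ₀ (π (FreeGroup.of k)) : M₂)) :
    ∃ r : (Fin g ⊕ Fin g → M₂) → (Fin g ⊕ Fin g → M₂), ContDiffAt ℂ ω r e₀ ∧ r e₀ = e₀ ∧
      (∀ᶠ e in 𝓝 e₀, ∃ ρ : Γ →* SL(2, ℂ), r e = fun k => (ρ (π (FreeGroup.of k)) : M₂)) ∧
      ∀ᶠ e in 𝓝 e₀, (∃ ρ : Γ →* SL(2, ℂ), e = fun k => (ρ (π (FreeGroup.of k)) : M₂)) → r e = e := by
  have hlift : ∀ (ρ : Γ →* SL(2, ℂ)) w,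
      FreeGroup.lift (fun k => ρ (π (FreeGroup.of k))) w = ρ (π w) := by
    intro ρ w
    have : FreeGroup.lift (fun k => ρ (π (FreeGroup.of k))) = ρ.comp π := by ext k; simp
    rw [this]; rfl
  have hrelρ : ∀ ρ : Γ →* SL(2, ℂ),
      FreeGroup.lift (fun k => ρ (π (FreeGroup.of k))) (surfaceRelator g) = 1 := fun ρ => by
    rw [hlift, hrel, map_one]
  have hval : ∀ ρ : Γ →* SL(2, ℂ),
      repEquations (fun k => (ρ (π (FreeGroup.of k)) : M₂)) = (fun _ => 2, 0) :=
    fun ρ => repEquations_coe (hrelρ ρ)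
  -- With the adjugate as the chosen inverse, the compatibility `hu` holds by definition.
  let u : Fin g ⊕ Fin g → M₂ˣ := fun k =>
    ⟨e₀ k, adjL (e₀ k), by rw [mul_adjL, he₀, (ρ₀ _).2, one_smul], by
      rw [adjL_apply, adjugate_mul, he₀, (ρ₀ _).2, one_smul]⟩
  have hcoe : (fun k => (u k : M₂)) = e₀ := rfl
  have hu : ∀ k, adjL (u k : M₂) = ((u k)⁻¹).val := fun k => rfl
  have hR : relMat (List.finRange g) e₀ = 1 := by
    rw [he₀, relMat_coe_lift, hrelρ]; rfl
  have hsurj : Function.Surjective (fderiv ℂ repEquations e₀) := by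
    rw [← hcoe]
    refine surjective_fderiv_repEquations hu ?_ ?_
    · apply Units.ext
      rw [← relMat_coe _ hu, hcoe, hR]; rfl
    · intro ξ hξ hcomm
      refine hρ₀.eq_zero_of_commute hξ fun γ => ?_
      obtain ⟨w, rfl⟩ := hπ γ
      obtain ⟨L, rfl⟩ : ∃ L, FreeGroup.mk L = w := ⟨w.toWord, FreeGroup.mk_toWord⟩
      rw [← hlift, ← wordMat_coe, ← he₀]
      refine Commute.list_prod_right _ _ fun X hX => ?_
      obtain ⟨x, -, rfl⟩ := List.mem_map.1 hX
      cases x.2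
      · exact (hcomm x.1).units_inv_right
      · exact hcomm x.1
  obtain ⟨r, hr, hr0, h1, h2⟩ := exists_local_retraction contDiff_repEquations.contDiffAt
    (contDiff_repEquations.differentiable (by simp) e₀).hasFDerivAt hsurj
  have hval0 : repEquations e₀ = (fun _ => 2, 0) := he₀ ▸ hval ρ₀
  refine ⟨r, hr, hr0, ?_, ?_⟩
  · have hc : ContinuousAt (fun e => relMat (List.finRange g) (r e) 0 0) e₀ := by
      have hc1 : ContinuousAt (fun e => relMat (List.finRange g) (r e)) e₀ :=
        ContinuousAt.comp (g := relMat (List.finRange g))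
          (contDiff_relMat _).continuous.continuousAt hr.continuousAt
      exact ((continuous_id.matrix_elem 0 0).continuousAt (x := _)).comp hc1
    have hne : ∀ᶠ e in 𝓝 e₀, relMat (List.finRange g) (r e) 0 0 ≠ -1 := by
      refine hc.eventually_ne ?_
      rw [hr0, hR]
      norm_num
    filter_upwards [h1, hne] with e he1 he2
    obtain ⟨u', hu', hu'rel⟩ := exists_of_repEquations_eq (he1.trans hval0) he2
    obtain ⟨ρ, hρ⟩ := huniv u' hu'rel
    exact ⟨ρ, by rw [hu']; funext k; rw [hρ]⟩
  · filter_upwards [h2] with e he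
    rintro ⟨ρ, rfl⟩
    exact he ((hval ρ).trans hval0.symm)

theorem contDiff_mvPolynomial_eval {n : ℕ} (P : MvPolynomial (Fin n) ℂ) :
    ContDiff ℂ ω fun x : Fin n → ℂ => MvPolynomial.eval x P := by
  induction P using MvPolynomial.induction_on with
  | C a => simpa using contDiff_const
  | add p q hp hq => simpa using hp.add hq
  | mul_X p i hp => simpa using hp.mul (contDiff_apply ℂ ℂ i)

/-- Near an irreducible character, characters lift analytically to representations. -/
theorem exists_section_repVariety {Γ ι : Type*} [Group Γ] [Fintype ι] (γ : ι → Γ)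
    {ρ₀ : Γ →* SL(2, ℂ)} (hρ₀ : IsIrreducibleRep ρ₀) {n : ℕ} {c : Fin n → Γ}
    (hc : IsTraceCoordinates c) :
    ∃ s : (Fin n → ℂ) → (ι → M₂), ContDiffAt ℂ ω s (traceCoord c (repCharacter ρ₀)) ∧
      s (traceCoord c (repCharacter ρ₀)) = (fun k => (ρ₀ (γ k) : M₂)) ∧
      ∀ᶠ x in 𝓝 (traceCoord c (repCharacter ρ₀)), x ∈ traceCoord c '' characterVariety Γ →
        ∃ ρ : Γ →* SL(2, ℂ), s x = (fun k => (ρ (γ k) : M₂)) ∧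
          traceCoord c (repCharacter ρ) = x := by
  obtain ⟨α, β, hαβ⟩ := hρ₀.exists_commutator_det_ne_zero
  choose P hP using hc
  have hP' : ∀ (δ : Γ) (ρ : Γ →* SL(2, ℂ)),
      MvPolynomial.eval (traceCoord c (repCharacter ρ)) (P δ) = (ρ δ : M₂).trace :=
    fun δ ρ => (hP δ _ ⟨ρ, rfl⟩).symm
  -- The trace data that a representation with coordinates `x` must have; each entry 2 is `tr (A *
  -- adjL A) = 2 det A` for a unimodular `A`.
  let q : (Fin n → ℂ) → (ℂ × ℂ × ℂ × ℂ × ℂ) × (ι → ℂ × ℂ × ℂ × ℂ) := fun x =>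
    ((2, MvPolynomial.eval x (P α), 2, MvPolynomial.eval x (P β), MvPolynomial.eval x (P (α * β))),
      fun k => (MvPolynomial.eval x (P (γ k)), MvPolynomial.eval x (P (γ k * α)),
        MvPolynomial.eval x (P (γ k * β)), MvPolynomial.eval x (P (γ k * (α * β)))))
  have hq : ContDiff ℂ ω q := by
    have h := fun δ => contDiff_mvPolynomial_eval (P δ)
    exact (contDiff_const.prodMk ((h _).prodMk (contDiff_const.prodMk ((h _).prodMk (h _))))).prodMk
      (contDiff_pi.2 fun k => (h _).prodMk ((h _).prodMk ((h _).prodMk (h _))))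
  have hqρ : ∀ ρ : Γ →* SL(2, ℂ), traceData (((ρ α : M₂), (ρ β : M₂)), fun k => (ρ (γ k) : M₂))
      = q (traceCoord c (repCharacter ρ)) := by
    intro ρ
    simp only [q, hP', traceData, traceL_apply, trace_mul_adjL, (ρ α).2, (ρ β).2, mul_one,
      coe_rep_mul]
  set x₀ := traceCoord c (repCharacter ρ₀) with hx₀
  set w₀ : (M₂ × M₂) × (ι → M₂) := (((ρ₀ α : M₂), (ρ₀ β : M₂)), fun k => (ρ₀ (γ k) : M₂)) with hw₀
  obtain ⟨σ, hσ, hσ0, hfσ⟩ := exists_local_section (contDiff_traceData.contDiffAt (x := w₀))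
    (contDiff_traceData.differentiable (by simp) w₀).hasFDerivAt (surjective_fderiv_traceData hαβ)
  rw [hqρ ρ₀] at hσ hσ0 hfσ
  have hσq : ContDiffAt ℂ ω (fun x => σ (q x)) x₀ := hσ.comp x₀ hq.contDiffAt
  refine ⟨fun x => (σ (q x)).2, hσq.snd, congrArg Prod.snd hσ0, ?_⟩
  have hev1 : ∀ᶠ x in 𝓝 x₀, traceData (σ (q x)) = q x :=
    hq.continuous.continuousAt.eventually hfσ
  -- The commutator determinant as a polynomial in `x`; it stays nonzero near `x₀`.
  let κ : (Fin n → ℂ) → ℂ := fun x => 4 - MvPolynomial.eval x (P α) ^ 2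
    - MvPolynomial.eval x (P β) ^ 2 - MvPolynomial.eval x (P (α * β)) ^ 2
    + MvPolynomial.eval x (P α) * MvPolynomial.eval x (P β) * MvPolynomial.eval x (P (α * β))
  have hκρ : ∀ ρ : Γ →* SL(2, ℂ), κ (traceCoord c (repCharacter ρ))
      = ((ρ α : M₂) * (ρ β : M₂) - (ρ β : M₂) * (ρ α : M₂)).det := by
    intro ρ
    rw [det_commutator_eq, (ρ α).2, (ρ β).2, ← coe_rep_mul]
    simp only [κ, hP']
    ring
  have hκ : Continuous κ := by
    have h := fun δ => (contDiff_mvPolynomial_eval (P δ)).continuous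
    exact (((continuous_const.sub ((h _).pow 2)).sub ((h _).pow 2)).sub ((h _).pow 2)).add
      (((h _).mul (h _)).mul (h _))
  have hev2 : ∀ᶠ x in 𝓝 x₀, κ x ≠ 0 :=
    hκ.continuousAt.eventually_ne (by rw [hκρ]; exact hαβ)
  filter_upwards [hev1, hev2] with x hx hκx
  rintro ⟨_, ⟨ρ, rfl⟩, rfl⟩
  rw [← hqρ] at hx
  rw [← hqρ]
  generalize σ _ = w at hx
  obtain ⟨⟨A, B⟩, m⟩ := w
  simp only [traceData, traceL_apply, Prod.mk.injEq, funext_iff] at hx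
  obtain ⟨⟨h1, h2, h3, h4, h5⟩, hm⟩ := hx
  have hdet : ∀ δ, ((ρ δ : M₂) * adjL (ρ δ : M₂)).trace = 2 := fun δ => by
    rw [trace_mul_adjL, (ρ δ).2, mul_one]
  obtain ⟨A, rfl⟩ := eq_coe_of_trace_mul_adjL (h1.trans (hdet α))
  obtain ⟨B, rfl⟩ := eq_coe_of_trace_mul_adjL (h3.trans (hdet β))
  rw [hκρ] at hκx
  have hAB : ((A : M₂) * (B : M₂) - (B : M₂) * (A : M₂)).det ≠ 0 := by
    rw [det_commutator_eq, (ρ α).2, (ρ β).2] at hκx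
    rwa [det_commutator_eq, A.2, B.2, h2, h4, h5]
  obtain ⟨Q, hQA, hQB⟩ := exists_conj_of_trace_eq hκx hAB h2.symm h4.symm h5.symm
  -- The section produced some tuple with the trace data of `ρ`. Conjugating `ρ` so that it matches
  -- the tuple at `α` and `β` makes it match everywhere, since the traces against `1, A, B, A * B`
  -- agree.
  let ρ' : Γ →* SL(2, ℂ) := (MulAut.conj Q).toMonoidHom.comp ρ
  have hρ'A : ρ' α = A := hQA
  have hρ'B : ρ' β = B := hQB
  have htr : ∀ δ, (ρ' δ : M₂).trace = (ρ δ : M₂).trace := fun δ => trace_conj_two Q (ρ δ)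
  refine ⟨ρ', funext fun k => ?_, funext fun i => htr (c i)⟩
  obtain ⟨m1, m2, m3, m4⟩ := hm k
  refine traceQuad_injective hAB (Prod.ext ?_ (Prod.ext ?_ (Prod.ext ?_ ?_)))
  · exact m1.trans (htr _).symm
  · change (m k * (A : M₂)).trace = ((ρ' (γ k) : M₂) * (A : M₂)).trace
    rw [m2, ← hρ'A, ← coe_rep_mul, ← coe_rep_mul, htr]
  · change (m k * (B : M₂)).trace = ((ρ' (γ k) : M₂) * (B : M₂)).trace
    rw [m3, ← hρ'B, ← coe_rep_mul, ← coe_rep_mul, htr]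
  · change (m k * ((A : M₂) * (B : M₂))).trace = ((ρ' (γ k) : M₂) * ((A : M₂) * (B : M₂))).trace
    rw [m4, ← hρ'A, ← hρ'B, ← coe_rep_mul, ← coe_rep_mul, ← coe_rep_mul, ← coe_rep_mul, htr]

/-- Irreducible characters are smooth points of the character variety of a surface group. -/
theorem IsSurfaceGroup.isSmoothPoint_repCharacter {Γ : Type*} [Group Γ] (hΓ : IsSurfaceGroup g Γ)
    {ρ₀ : Γ →* SL(2, ℂ)} (hρ₀ : IsIrreducibleRep ρ₀) {n : ℕ} {c : Fin n → Γ}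
    (hc : IsTraceCoordinates c) :
    IsSmoothPoint (traceCoord c '' characterVariety Γ) (traceCoord c (repCharacter ρ₀)) := by
  obtain ⟨π, hπ, hrel, huniv⟩ := hΓ.exists_presentation
  obtain ⟨s, hs, hs0, hsx⟩ :=
    exists_section_repVariety (fun k => π (FreeGroup.of k)) hρ₀ hc
  obtain ⟨r, hr, hr0, hrV, hVr⟩ := exists_retraction_repVariety hπ hrel huniv hρ₀ rfl
  have hword : ∀ i, ∃ L : List ((Fin g ⊕ Fin g) × Bool), π (FreeGroup.mk L) = c i := by
    intro i
    obtain ⟨w, hw⟩ := hπ (c i)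
    exact ⟨w.toWord, by rw [FreeGroup.mk_toWord, hw]⟩
  choose L hL using hword
  let t : (Fin g ⊕ Fin g → M₂) → Fin n → ℂ := fun e i => traceL (wordMat (L i) e)
  have ht : ContDiff ℂ ω t := contDiff_pi.2 fun i => traceL.contDiff.comp (contDiff_wordMat (L i))
  have htρ : ∀ ρ : Γ →* SL(2, ℂ), t (fun k => (ρ (π (FreeGroup.of k)) : M₂))
      = traceCoord c (repCharacter ρ) := by
    intro ρ
    funext i
    have : FreeGroup.lift (fun k => ρ (π (FreeGroup.of k))) = ρ.comp π := by ext k; simp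
    simp only [t, wordMat_coe, this, MonoidHom.comp_apply, hL]
    rfl
  rw [← hs0] at hr hr0 hrV hVr
  set y₀ := traceCoord c (repCharacter ρ₀) with hy₀
  -- The retraction onto the character variety. It is complex analytic, hence real analytic.
  have hR : ContDiffAt ℂ ω (fun x => t (r (s x))) y₀ :=
    ht.contDiffAt.comp y₀ (hr.comp y₀ hs)
  refine isSmoothPoint_of_retraction ⟨_, ⟨ρ₀, rfl⟩, rfl⟩ (hR.restrict_scalars ℝ) ?_ ?_
  · filter_upwards [hs.continuousAt.eventually hrV] with x ⟨ρ, hρ⟩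
    rw [hρ, htρ]
    exact ⟨_, ⟨ρ, rfl⟩, rfl⟩
  · filter_upwards [hsx, hs.continuousAt.eventually hVr] with x h1 h2 hxV
    obtain ⟨ρ, hρ, hρx⟩ := h1 hxV
    rw [h2 ⟨ρ, hρ⟩, hρ, htρ, hρx]

end SurfaceGroup

theorem theorem4p7 {g : ℕ} (hg : 2 ≤ g) {Γ : Type*} [Group Γ] (hΓ : IsSurfaceGroup g Γ)
    (x₀ : Γ → ℂ) (ρ₀ : Γ →* SL(2, ℂ)) (hρ₀ : IsIrreducibleRep ρ₀) (hx₀ : x₀ = repCharacter ρ₀)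
    {n : ℕ} (c : Fin n → Γ) (hc : IsTraceCoordinates c) :
    IsSmoothPoint (traceCoord c '' characterVariety Γ) (traceCoord c x₀) :=
  hx₀ ▸ hΓ.isSmoothPoint_repCharacter hρ₀ hc
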